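/- There is a universal constant $c>0$ with the following property. Let $1\le p\le n$ be integers, $\beta>0$, and let $M=[t_{ij}]_{1\le i\le p,\,1\le j\le n}$ be a random $p\times n$ matrix whose entries are independent (not necessarily identically distributed) complex random variables with $$\mathbf E(t_{ij})=0,\qquad \mathbf E(|t_{ij}|^2)=1,\qquad \mathbf E(|t_{ij}|^4)\le\beta\quad\text{for all } i,j.$$ Put $W:=M^*M$, $\phi:=p/n\in(0,1]$, $a:=(1-\sqrt\phi)^2$, $b:=(1+\sqrt\phi)^2$, and let $$\mu_\phi:=(1-\phi)\,\delta_0+\frac{1}{2\pi t}\sqrt{\big((t-a)(b-t)\big)_+}\;dt,\qquad x_+:=\max(x,0),$$ be the Marchenko–Pastur law, with logarithmic potential $u_\phi(z):=\int\log|z-t|\,d\mu_\phi(t)$. Then for every $z\in[a,b]$ the random variable $|\det(z-n^{-1}W)|^2$ is integrable and $$\mathbf E\big(|\det(z-n^{-1}W)|^2\big)\le c\,p^{13/2}\,n^{1/2}\,e^{\beta}\,e^{2n\,u_\phi(z)}.$$ -/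

import Mathlib

open MeasureTheory ProbabilityTheory
open scoped Matrix

noncomputable section

namespace MarchenkoPastur

/-- Left endpoint `a = (1 - √φ)²` of the bulk. -/
def lower (φ : ℝ) : ℝ := (1 - √φ) ^ 2

/-- Right endpoint `b = (1 + √φ)²` of the bulk. -/
def upper (φ : ℝ) : ℝ := (1 + √φ) ^ 2

/-- Density `(2πt)⁻¹ √(((t - a)(b - t))₊)` of the absolutely continuous part. -/
def density (φ t : ℝ) : ℝ :=
  1 / (2 * Real.pi * t) * √(max ((t - lower φ) * (upper φ - t)) 0)

/-- The Marchenko–Pastur law `μ_φ = (1 - φ) δ₀ + (2πt)⁻¹ √(((t - a)(b - t))₊) dt`,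
for `φ ∈ (0, 1]`. -/
def law (φ : ℝ) : Measure ℝ :=
  ENNReal.ofReal (1 - φ) • Measure.dirac 0 +
    volume.withDensity (fun t => ENNReal.ofReal (density φ t))

/-- Logarithmic potential `u(z) = ∫ log |z - t| dμ(t)` of a measure on the real line. -/
def logPotential (μ : Measure ℝ) (z : ℂ) : ℝ :=
  ∫ t, Real.log ‖z - (t : ℂ)‖ ∂μ

/-- The covariance matrix `W = M* M`. -/
def covMatrix {p n : ℕ} (M : Matrix (Fin p) (Fin n) ℂ) : Matrix (Fin n) (Fin n) ℂ :=
  Mᴴ * M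

end MarchenkoPastur

end

/-!
With `x = n z`, the quantity `|det (z - n⁻¹ W)|²` is `n⁻²ⁿ x^(2(n-p)) |det (x - M M*)|²`. The
Cauchy–Binet formula gives `det (x - M M*) = ∑_S ± L_S(x) D_S`, where `S` runs over the sets of rows
of `M`, `L_S` is a multiple of the Laguerre polynomial of degree `p - |S|` and parameter `n - p`,
and `D_S` is the mixed minor of the centred rank-one matrices `v v* - 1` of the rows `v` in `S`.
Centring makes the `D_S` orthogonal. In `E |D_S|²` a pair of terms contributes only if in each row
their index pairs agree or are swapped, and counting such pairs of terms yields
`E |D_S|² ≤ n (n-1) ⋯ (n-|S|+1) (|S|+1)! e^(β-1)`.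

Since `L_∅(x)` is the `p`-th derivative at `0` of `e^(x t) (1 - t)ⁿ`, Cauchy's estimate on a
suitable circle yields `|L_∅(x)|² x^(n-p) ≤ e √p p! n! e^x`, and similarly for every `L_S`.

In the bulk, `u(z) = (z + (1 - φ) log z + φ log φ - 1 - φ) / 2`: under `t = |1 + √φ e^{iθ}|²` the
law `μ_φ` becomes a combination of `dθ`, `cos θ dθ` and a Poisson kernel, while `log |z - t|` splits
into logarithms of chords of the unit circle, whose integrals against these are explicit. Stirling's
bound for `p! n!` then turns the moment estimate into a multiple of `e^(2 n u(z))`.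
-/

namespace MarchenkoPastur

section Minors

lemma sum_embedding_comp {α ι κ M : Type*} [Fintype α] [Fintype ι] [Fintype κ] [AddCommMonoid M]
    (f : α ↪ ι) (G : (α ↪ κ) → M) :
    ∑ σ : ι ↪ κ, G (f.trans σ) =
      (Fintype.card κ - Fintype.card α).descFactorial (Fintype.card ι - Fintype.card α) •
        ∑ τ : α ↪ κ, G τ := by
  classical
  let split : ι ≃ α ⊕ {i // i ∉ Set.range f} :=
    (Equiv.sumCompl (· ∈ Set.range f)).symm.trans
      (Equiv.sumCongr (Equiv.ofInjective f f.injective).symm (Equiv.refl _))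
  let e : (ι ↪ κ) ≃ Σ τ : α ↪ κ, {i // i ∉ Set.range f} ↪ ↥(Set.range τ)ᶜ :=
    (Equiv.embeddingCongr split (Equiv.refl κ)).trans
      Equiv.sumEmbeddingEquivSigmaEmbeddingRestricted
  have e_fst (σ : ι ↪ κ) : (e σ).1 = f.trans σ := rfl
  have card_extensions (τ : α ↪ κ) :
      Fintype.card ({i // i ∉ Set.range f} ↪ ↥(Set.range τ)ᶜ) =
        (Fintype.card κ - Fintype.card α).descFactorial (Fintype.card ι - Fintype.card α) := by
    rw [Fintype.card_embedding_eq, Fintype.card_compl_set, Fintype.card_subtype_compl,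
      Set.card_range_of_injective τ.injective]
    congr 2
    exact Set.card_range_of_injective f.injective
  simp_rw [← e_fst]
  rw [e.sum_comp fun y => G y.1, Fintype.sum_sigma, Finset.smul_sum]
  refine Finset.sum_congr rfl fun τ _ => ?_
  rw [← card_extensions τ, ← Finset.card_univ, ← Finset.sum_const]

variable {R ι κ : Type*} [CommRing R] [DecidableEq ι] [Fintype κ]

lemma det_mul_eq_sum_embedding [Fintype ι] (A : Matrix ι κ R) (B : Matrix κ ι R) :
    (A * B).det =
      ∑ σ : ι ↪ κ, (Matrix.of fun a b => A a (σ a) * B (σ b) a).det := by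
  classical
  have expand_rows : (A * B).det =
      ∑ σ : ι → κ, (Matrix.of fun a b => A a (σ a) * B (σ a) b).det := by
    rw [show A * B = fun a => ∑ j, fun b => A a j * B j b by ext a b; simp [Matrix.mul_apply]]
    exact (Matrix.detRowAlternating (n := ι) (R := R)).toMultilinearMap.map_sum
      fun a j b => A a j * B j b
  have transpose (σ : ι → κ) : (Matrix.of fun a b => A a (σ a) * B (σ a) b).det =
      (Matrix.of fun a b => A a (σ a) * B (σ b) a).det := by
    refine (Matrix.det_mul_column (fun a => A a (σ a)) (B.submatrix σ id)).trans ?_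
    rw [← Matrix.det_transpose]
    exact (Matrix.det_mul_column (fun a => A a (σ a)) (B.submatrix σ id)ᵀ).symm
  have vanish (σ : ι → κ) (hσ : ¬ σ.Injective) :
      (Matrix.of fun a b => A a (σ a) * B (σ b) a).det = 0 := by
    obtain ⟨a, b, hab, hne⟩ := Function.not_injective_iff.mp hσ
    exact Matrix.det_zero_of_column_eq hne fun k => by simp [hab]
  simp_rw [expand_rows, transpose]
  rw [← Finset.sum_filter_of_ne fun σ _ => not_imp_comm.mp (vanish σ),
    Finset.sum_subtype _ (p := Function.Injective) (by simp)]
  exact (Equiv.subtypeInjectiveEquivEmbedding ι κ).sum_comp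
    fun σ : ι ↪ κ => (Matrix.of fun a b => A a (σ a) * B (σ b) a).det

lemma det_scalar_sub [Fintype ι] (B : Matrix ι ι R) (x : R) :
    (Matrix.scalar ι x - B).det =
      ∑ T : Finset ι, (-1) ^ T.card * x ^ (Fintype.card ι - T.card) *
        (B.submatrix (Subtype.val : T → ι) Subtype.val).det := by
  nontriviality R
  rw [← Matrix.eval_charpoly, Polynomial.eval_eq_sum_range, Matrix.charpoly_natDegree_eq_dim,
    ← Finset.sum_range_reflect, ← Finset.powerset_univ, Finset.sum_powerset, Finset.card_univ]
  refine Finset.sum_congr rfl fun k hk => ?_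
  rw [Nat.add_sub_cancel, Matrix.charpoly_coeff_eq_sum_minors _ _ (Finset.mem_range_succ_iff.mp hk),
    Finset.mul_sum, Finset.sum_mul]
  refine Finset.sum_congr rfl fun T hT => ?_
  rw [(Finset.mem_powersetCard.mp hT).2]
  ring

lemma det_add_one [Fintype ι] (X : Matrix ι ι R) :
    (X + 1).det = ∑ S : Finset ι, (X.submatrix (Subtype.val : S → ι) Subtype.val).det := by
  simp_rw [← Matrix.det_piecewise_one_eq_submatrix_det]
  exact (Matrix.detRowAlternating (n := ι) (R := R)).toMultilinearMap.map_add_univ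
    X.row (1 : Matrix ι ι R).row

/-- The mixed minor `∑_σ det (A_a(σ a, σ b))_{a, b}` of a family of matrices, the sum being over
the embeddings `σ` of the index type. If every `A_a` is the rank-one matrix of the `a`-th row of
`M`, this is the Gram determinant `det (M M*)`. -/
noncomputable def mixedMinor (A : ι → Matrix κ κ R) [Fintype ι] : R :=
  ∑ σ : ι ↪ κ, (Matrix.of fun a b => A a (σ a) (σ b)).det

lemma mixedMinor_comp_equiv {α : Type*} [Fintype α] [DecidableEq α] [Fintype ι] (e : α ≃ ι)
    (A : ι → Matrix κ κ R) : mixedMinor (fun a => A (e a)) = mixedMinor A := by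
  rw [mixedMinor, mixedMinor, ← (e.embeddingCongr (Equiv.refl κ)).symm.sum_comp]
  refine Finset.sum_congr rfl fun σ _ => ?_
  exact Matrix.det_submatrix_equiv_self e (Matrix.of fun a b => A a (σ a) (σ b))

lemma mixedMinor_add_one [Fintype ι] [DecidableEq κ] (A : ι → Matrix κ κ R) :
    mixedMinor (fun a => A a + 1) =
      ∑ S : Finset ι, (Fintype.card κ - S.card).descFactorial (Fintype.card ι - S.card) •
        mixedMinor fun a : S => A a := by
  have expand (σ : ι ↪ κ) : (Matrix.of fun a b => (A a + 1) (σ a) (σ b)).det =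
      ∑ S : Finset ι, (Matrix.of fun a b : S => A a (σ a) (σ b)).det := by
    refine Eq.trans (congrArg Matrix.det ?_) (det_add_one (Matrix.of fun a b => A a (σ a) (σ b)))
    ext a b
    simp [Matrix.one_apply]
  simp_rw [mixedMinor, expand]
  rw [Finset.sum_comm]
  refine Finset.sum_congr rfl fun S _ => ?_
  rw [← Fintype.card_coe S]
  exact sum_embedding_comp (.subtype (· ∈ S))
    fun τ => (Matrix.of fun a b : S => A a (τ a) (τ b)).det

lemma sum_finset_subtype_map {α M : Type*} [AddCommMonoid M] (T : Finset α) (F : Finset α → M) :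
    ∑ S : Finset T, F (S.map (.subtype (· ∈ T))) = ∑ S ∈ T.powerset, F S := by
  classical
  refine Finset.sum_bij' (fun S _ => S.map (.subtype (· ∈ T))) (fun S _ => S.subtype (· ∈ T))
    (fun S _ => ?_) (fun S _ => Finset.mem_univ _) (fun S _ => ?_) (fun S hS => ?_)
    (fun S _ => rfl)
  · exact Finset.mem_powerset.mpr fun _ => Finset.property_of_mem_map_subtype S
  · exact Finset.map_injective (.subtype _)
      (Finset.subtype_map_of_mem fun _ => Finset.property_of_mem_map_subtype S)
  · exact Finset.subtype_map_of_mem (Finset.mem_powerset.mp hS)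

lemma mixedMinor_restrict_add_one [DecidableEq κ] (A : ι → Matrix κ κ R) (T : Finset ι) :
    mixedMinor (fun a : T => A a + 1) =
      ∑ S ∈ T.powerset, (Fintype.card κ - S.card).descFactorial (T.card - S.card) •
        mixedMinor fun a : S => A a := by
  rw [mixedMinor_add_one, ← sum_finset_subtype_map]
  refine Finset.sum_congr rfl fun S _ => ?_
  rw [Finset.card_map, Fintype.card_coe]
  congr 1
  exact mixedMinor_comp_equiv (S.equivMap (.subtype (· ∈ T))) fun a => A a

lemma sum_supersets_apply_card [Fintype ι] {M : Type*} [AddCommMonoid M] (S : Finset ι)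
    (F : ℕ → M) :
    ∑ T : Finset ι with S ⊆ T, F T.card =
      ∑ k ∈ Finset.range (Fintype.card ι - S.card + 1),
        (Fintype.card ι - S.card).choose k • F (S.card + k) := by
  rw [← Finset.card_compl, ← Finset.sum_powerset_apply_card fun k => F (S.card + k)]
  refine Finset.sum_bij' (fun T _ => T \ S) (fun T _ => S ∪ T) (fun T _ => ?_) (fun T _ => ?_)
    (fun T hT => ?_) (fun T hT => ?_) (fun T hT => ?_)
  · exact Finset.mem_powerset.mpr fun a ha => by simpa using (Finset.mem_sdiff.mp ha).2
  · simp
  · exact Finset.union_sdiff_of_subset (Finset.mem_filter.mp hT).2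
  · exact Finset.union_sdiff_cancel_left
      (Finset.subset_compl_iff_disjoint_left.mp (Finset.mem_powerset.mp hT))
  · rw [add_comm, Finset.card_sdiff_add_card_eq_card (Finset.mem_filter.mp hT).2]

/-- The polynomial `∑ₖ (-1)ᵏ C(p,k) (n)ₖ x^(p-k)`, which for `p ≤ n` is `(-1)ᵖ p!` times the
generalised Laguerre polynomial of degree `p` and parameter `n - p`. -/
def laguerre (p n : ℕ) (x : R) : R :=
  ∑ k ∈ Finset.range (p + 1), (-1) ^ k * p.choose k * n.descFactorial k * x ^ (p - k)

lemma det_submatrix_mul (A : Matrix ι κ R) (B : Matrix κ ι R) (T : Finset ι) :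
    ((A * B).submatrix (Subtype.val : T → ι) Subtype.val).det =
      mixedMinor fun a : T => Matrix.vecMulVec (A.row a) (B.col a) := by
  rw [Matrix.submatrix_mul A B _ id _ Function.bijective_id, det_mul_eq_sum_embedding]
  rfl

/- Grouping the minors of `A * B` by the set of rows whose rank-one matrix is replaced by its
centred version turns the coefficient of each mixed minor into a Laguerre polynomial. -/
lemma det_scalar_sub_mul [Fintype ι] [DecidableEq κ] (A : Matrix ι κ R) (B : Matrix κ ι R)
    (x : R) :
    (Matrix.scalar ι x - A * B).det =
      ∑ S : Finset ι, (-1) ^ S.card *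
        laguerre (Fintype.card ι - S.card) (Fintype.card κ - S.card) x *
          mixedMinor fun a : S => Matrix.vecMulVec (A.row a) (B.col a) - 1 := by
  set minor : Finset ι → R := fun S =>
    mixedMinor fun a : S => Matrix.vecMulVec (A.row a) (B.col a) - 1
  have expand (T : Finset ι) : ((A * B).submatrix (Subtype.val : T → ι) Subtype.val).det =
      ∑ S ∈ T.powerset, (Fintype.card κ - S.card).descFactorial (T.card - S.card) • minor S := by
    rw [← mixedMinor_restrict_add_one fun a => Matrix.vecMulVec (A.row a) (B.col a) - 1,
      det_submatrix_mul]
    simp only [sub_add_cancel]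
  simp_rw [det_scalar_sub, expand, Finset.mul_sum]
  rw [Finset.sum_comm' (t' := Finset.univ) (s' := fun S => {T | S ⊆ T}) (by simp)]
  refine Finset.sum_congr rfl fun S _ => ?_
  rw [sum_supersets_apply_card S fun k => (-1) ^ k * x ^ (Fintype.card ι - k) *
    (Fintype.card κ - S.card).descFactorial (k - S.card) • minor S, laguerre, Finset.mul_sum,
    Finset.sum_mul]
  refine Finset.sum_congr rfl fun k _ => ?_
  simp only [nsmul_eq_mul, Nat.add_sub_cancel_left, Nat.sub_add_eq, pow_add]
  ring

end Minors

section Counting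

open Equiv (Perm)
open scoped Nat

lemma sum_powerset_factorial_mul_factorial {α : Type*} [DecidableEq α] (T : Finset α) :
    ∑ A ∈ T.powerset, A.card ! * (T \ A).card ! = (T.card + 1)! := by
  calc ∑ A ∈ T.powerset, A.card ! * (T \ A).card !
      = ∑ A ∈ T.powerset, A.card ! * (T.card - A.card)! :=
        Finset.sum_congr rfl fun A hA => by
          rw [Finset.card_sdiff_of_subset (Finset.mem_powerset.mp hA)]
    _ = ∑ k ∈ Finset.range (T.card + 1), T.card.choose k * (k ! * (T.card - k)!) :=
        Finset.sum_powerset_apply_card fun k => k ! * (T.card - k)!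
    _ = ∑ _k ∈ Finset.range (T.card + 1), T.card ! :=
        Finset.sum_congr rfl fun k hk => by
          rw [← mul_assoc, Nat.choose_mul_factorial_mul_factorial (Finset.mem_range_succ_iff.mp hk)]
    _ = (T.card + 1)! := by simp [Nat.factorial_succ]

lemma choose_mul_factorial_mul_succ_factorial_le {k m : ℕ} (hk : k ≤ m) :
    m.choose k * k ! * (m - k + 1)! ≤ (m + 1)! := by
  rw [Nat.factorial_succ, Nat.factorial_succ, mul_left_comm,
    Nat.choose_mul_factorial_mul_factorial hk]
  gcongr
  exact Nat.sub_le m k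

lemma sum_powerset_pow_mul_factorial_le {α : Type*} [DecidableEq α] {b : ℝ} (hb : 0 ≤ b)
    (T : Finset α) :
    ∑ K ∈ T.powerset, b ^ K.card * ((T \ K).card + 1)! ≤ (T.card + 1)! * Real.exp b := by
  have term_le (k : ℕ) (hk : k ∈ Finset.range (T.card + 1)) :
      T.card.choose k • (b ^ k * ((T.card - k + 1)! : ℝ)) ≤ (T.card + 1)! * (b ^ k / k !) := by
    have : (T.card.choose k * k ! * (T.card - k + 1)! : ℝ) ≤ (T.card + 1)! :=
      mod_cast choose_mul_factorial_mul_succ_factorial_le (Finset.mem_range_succ_iff.mp hk)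
    rw [nsmul_eq_mul, mul_div_assoc', le_div_iff₀ (by positivity)]
    linear_combination b ^ k * this
  calc ∑ K ∈ T.powerset, b ^ K.card * ((T \ K).card + 1)!
      = ∑ K ∈ T.powerset, b ^ K.card * ((T.card - K.card + 1)! : ℝ) :=
        Finset.sum_congr rfl fun K hK => by
          rw [Finset.card_sdiff_of_subset (Finset.mem_powerset.mp hK)]
    _ = ∑ k ∈ Finset.range (T.card + 1), T.card.choose k • (b ^ k * ((T.card - k + 1)! : ℝ)) :=
        Finset.sum_powerset_apply_card fun k => b ^ k * ((T.card - k + 1)! : ℝ)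
    _ ≤ ∑ k ∈ Finset.range (T.card + 1), (T.card + 1)! * (b ^ k / k !) := Finset.sum_le_sum term_le
    _ ≤ (T.card + 1)! * Real.exp b := by
        rw [← Finset.mul_sum]
        gcongr
        exact Real.sum_le_exp_of_nonneg hb _

variable {α κ : Type*}

/-- Two injections `q.1`, `r.1` into `κ`, each with a permutation, assign the index pairs
`(q.1 a, q.1 (q.2 a))` and `(r.1 a, r.1 (r.2 a))` to every `a`. They are compatible if these four
indices coincide for `a ∈ K`, and the two pairs agree for `a ∈ A` and are swapped elsewhere. -/
structure Compatible (K A : Finset α) (q r : (α ↪ κ) × Perm α) : Prop where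
  coincident : ∀ a ∈ K, q.1 a = q.1 (q.2 a) ∧ q.1 a = r.1 a ∧ q.1 a = r.1 (r.2 a)
  parallel : ∀ a ∈ A, q.1 a = r.1 a ∧ q.1 (q.2 a) = r.1 (r.2 a)
  crossed : ∀ a ∉ K, a ∉ A → q.1 a = r.1 (r.2 a) ∧ q.1 (q.2 a) = r.1 a

/-- The colouring whose classes are the points of `K`, the set `A \ K` and the remaining points. A
permutation in a compatible pair preserves it, which is what limits their number. -/
def classColour [DecidableEq α] (K A : Finset α) (a : α) : α ⊕ Bool :=
  if a ∈ K then .inl a else .inr (decide (a ∈ A))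

namespace Compatible

variable {K A : Finset α} {q r s : (α ↪ κ) × Perm α}

lemma perm_apply_of_mem (h : Compatible K A q r) {a : α} (ha : a ∈ K) : q.2 a = a :=
  (q.1.injective (h.coincident a ha).1).symm

lemma mem_of_perm_apply_mem (h : Compatible K A q r) {a : α} (ha : q.2 a ∈ K) : a ∈ K := by
  rwa [q.2.injective (h.perm_apply_of_mem ha)] at ha

lemma mem_of_perm_apply_mem' (h : Compatible K A q r) {a : α} (haK : a ∉ K) (ha : q.2 a ∈ A) :
    a ∈ A := by
  by_contra haA
  have : r.1 (q.2 a) = r.1 a := (h.parallel _ ha).1.symm.trans (h.crossed a haK haA).2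
  exact haA (r.1.injective this ▸ ha)

lemma perm_apply_mem (h : Compatible K A q r) {a : α} (haK : a ∉ K) (ha : a ∈ A) :
    q.2 a ∈ A := by
  by_contra hqa
  have : r.1 (r.2 (q.2 a)) = r.1 (r.2 a) :=
    (h.crossed _ (mt h.mem_of_perm_apply_mem haK) hqa).1.symm.trans (h.parallel a ha).2
  exact hqa ((r.2.injective (r.1.injective this)).symm ▸ ha)

lemma classColour_comp [DecidableEq α] (h : Compatible K A q r) :
    classColour K A ∘ q.2 = classColour K A := by
  ext1 a
  by_cases haK : a ∈ K
  · simp [h.perm_apply_of_mem haK]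
  · have hqa : q.2 a ∉ K := mt h.mem_of_perm_apply_mem haK
    simp only [Function.comp_apply, classColour, haK, hqa, if_false,
      decide_eq_decide.mpr ⟨h.mem_of_perm_apply_mem' haK, h.perm_apply_mem haK⟩]

lemma right_unique (hr : Compatible K A q r) (hs : Compatible K A q s) : r = s := by
  have fst_eq : r.1 = s.1 := by
    ext a
    by_cases haK : a ∈ K
    · rw [← (hr.coincident a haK).2.1, (hs.coincident a haK).2.1]
    by_cases haA : a ∈ A
    · rw [← (hr.parallel a haA).1, (hs.parallel a haA).1]
    · rw [← (hr.crossed a haK haA).2, (hs.crossed a haK haA).2]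
  refine Prod.ext fst_eq (Equiv.ext fun a => s.1.injective ?_)
  rw [← fst_eq]
  by_cases haK : a ∈ K
  · rw [← (hr.coincident a haK).2.2, (hs.coincident a haK).2.2, fst_eq]
  by_cases haA : a ∈ A
  · rw [← (hr.parallel a haA).2, (hs.parallel a haA).2, fst_eq]
  · rw [← (hr.crossed a haK haA).1, (hs.crossed a haK haA).1, fst_eq]

end Compatible

variable [Fintype α] [DecidableEq α]

lemma card_classColour_stabilizer_le (K A : Finset α) :
    Fintype.card {g : Perm α // classColour K A ∘ g = classColour K A} ≤
      A.card ! * (Kᶜ \ A).card ! := by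
  have singleton_class (a : α) : (Fintype.card {b // classColour K A b = .inl a})! = 1 := by
    refine Nat.factorial_eq_one.mpr (Fintype.card_le_one_iff_subsingleton.mpr ⟨?_⟩)
    rintro ⟨b, hb⟩ ⟨c, hc⟩
    simp only [classColour] at hb hc
    grind
  rw [DomMulAct.stabilizer_card, Fintype.prod_sum_type, Finset.prod_congr rfl fun a _ =>
    singleton_class a, Finset.prod_const_one, one_mul, Fintype.prod_bool]
  gcongr <;>
  · rw [Fintype.card_subtype]
    refine Finset.card_le_card fun a ha => ?_
    have := (Finset.mem_filter.mp ha).2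
    simp only [Finset.mem_sdiff, Finset.mem_compl, classColour] at this ⊢
    grind

variable [Fintype κ]

open Classical in
lemma card_compatible_le (K A : Finset α) :
    (Finset.univ.filter fun qr : ((α ↪ κ) × Perm α) × (α ↪ κ) × Perm α =>
      Compatible K A qr.1 qr.2).card ≤
      (Fintype.card κ).descFactorial (Fintype.card α) * (A.card ! * (Kᶜ \ A).card !) := by
  calc _ ≤ ((Finset.univ : Finset (α ↪ κ)) ×ˢ
        (Finset.univ.filter fun g : Perm α => classColour K A ∘ g = classColour K A)).card := by
        refine Finset.card_le_card_of_injOn Prod.fst (fun qr hqr => ?_) fun x hx y hy hxy => ?_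
        · simpa using (Finset.mem_filter.mp hqr).2.classColour_comp
        · simp only [Finset.coe_filter, Finset.mem_univ, true_and, Set.mem_ofPred_eq] at hx hy
          exact Prod.ext hxy (hx.right_unique (hxy ▸ hy))
    _ ≤ _ := by
        rw [Finset.card_product, Finset.card_univ, Fintype.card_embedding_eq,
          ← Fintype.card_subtype]
        exact Nat.mul_le_mul_left _ (card_classColour_stabilizer_le K A)

/-- The bound for the covariance of the entries `(j, k)` and `(j', k')` of a centred rank-one
matrix whose vector has fourth absolute moments at most `b + 1`. -/
def covBound [DecidableEq κ] (b : ℝ) (j k j' k' : κ) : ℝ :=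
  (if j = k ∧ j = j' ∧ j = k' then b else 0) +
    ((if j = j' ∧ k = k' then 1 else 0) + if j = k' ∧ k = j' then 1 else 0)

open Classical in
lemma prod_covBound_eq {κ : Type*} [DecidableEq κ] (b : ℝ) (q r : (α ↪ κ) × Perm α) :
    ∏ a, covBound b (q.1 a) (q.1 (q.2 a)) (r.1 a) (r.1 (r.2 a)) =
      ∑ K : Finset α, ∑ A ∈ Kᶜ.powerset, if Compatible K A q r then b ^ K.card else 0 := by
  simp only [covBound]
  rw [Finset.prod_add, Finset.powerset_univ]
  refine Finset.sum_congr rfl fun K _ => ?_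
  rw [Finset.prod_add, Finset.mul_sum, ← Finset.compl_eq_univ_sdiff]
  refine Finset.sum_congr rfl fun A _ => ?_
  simp only [Finset.prod_ite_zero, Finset.prod_const, one_pow, ← ite_and, mul_ite, mul_one,
    mul_zero]
  have mem_rest (a : α) : a ∈ Kᶜ \ A ↔ a ∉ K ∧ a ∉ A := by simp
  simp only [mem_rest, and_imp]
  exact if_congr ⟨fun h => ⟨h.2, h.1.2, h.1.1⟩, fun h => ⟨⟨h.crossed, h.parallel⟩, h.coincident⟩⟩
    rfl rfl

lemma sum_prod_covBound_le [DecidableEq κ] {b : ℝ} (hb : 0 ≤ b) :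
    ∑ q : (α ↪ κ) × Perm α, ∑ r : (α ↪ κ) × Perm α,
      ∏ a, covBound b (q.1 a) (q.1 (q.2 a)) (r.1 a) (r.1 (r.2 a)) ≤
      (Fintype.card κ).descFactorial (Fintype.card α) *
        ((Fintype.card α + 1)! * Real.exp b) := by
  classical
  have sum_compatible (K A : Finset α) :
      ∑ qr : ((α ↪ κ) × Perm α) × (α ↪ κ) × Perm α,
        (if Compatible K A qr.1 qr.2 then b ^ K.card else 0) ≤
      (Fintype.card κ).descFactorial (Fintype.card α) * b ^ K.card *
        (A.card ! * (Kᶜ \ A).card ! : ℕ) := by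
    rw [← Finset.sum_filter, Finset.sum_const, nsmul_eq_mul, mul_right_comm]
    gcongr
    exact_mod_cast card_compatible_le (κ := κ) K A
  calc _ = ∑ K : Finset α, ∑ A ∈ Kᶜ.powerset,
        ∑ qr : ((α ↪ κ) × Perm α) × (α ↪ κ) × Perm α,
          if Compatible K A qr.1 qr.2 then b ^ K.card else 0 := by
        rw [← Fintype.sum_prod_type', Finset.sum_congr rfl fun qr _ => prod_covBound_eq b qr.1 qr.2,
          Finset.sum_comm]
        exact Finset.sum_congr rfl fun K _ => Finset.sum_comm
    _ ≤ ∑ K : Finset α, ∑ A ∈ Kᶜ.powerset, (Fintype.card κ).descFactorial (Fintype.card α) *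
        b ^ K.card * (A.card ! * (Kᶜ \ A).card ! : ℕ) :=
        Finset.sum_le_sum fun K _ => Finset.sum_le_sum fun A _ => sum_compatible K A
    _ = (Fintype.card κ).descFactorial (Fintype.card α) *
        ∑ K ∈ (Finset.univ : Finset α).powerset, b ^ K.card * ((Finset.univ \ K).card + 1)! := by
        rw [Finset.mul_sum, Finset.powerset_univ]
        refine Finset.sum_congr rfl fun K _ => ?_
        rw [← Finset.mul_sum, ← Nat.cast_sum, sum_powerset_factorial_mul_factorial, mul_assoc,
          Finset.compl_eq_univ_sdiff]
    _ ≤ _ := by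
        gcongr
        exact sum_powerset_pow_mul_factorial_le hb Finset.univ

end Counting

section Moments

variable {Ω : Type*} [MeasurableSpace Ω] {P : Measure Ω}

lemma exists_measurable_comp_of_dependsOn {τ E F : Type*} [MeasurableSpace E] [Nonempty E]
    [MeasurableSpace F] {s : Set τ} {f : (τ → E) → F} (hf : Measurable f) (hs : DependsOn f s) :
    ∃ g : (s → E) → F, Measurable g ∧ ∀ v, f v = g fun a => v a := by
  classical
  let e := Classical.arbitrary E
  refine ⟨fun w => f fun a => if ha : a ∈ s then w ⟨a, ha⟩ else e, hf.comp ?_, fun v => ?_⟩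
  · refine measurable_pi_iff.mpr fun a => ?_
    by_cases ha : a ∈ s
    · simp only [ha, dite_true]
      fun_prop
    · simp [ha]
  · exact hs fun a ha => by simp [ha]

lemma indepFun_of_dependsOn {τ E F G : Type*} [MeasurableSpace E] [Nonempty E]
    [MeasurableSpace F] [MeasurableSpace G] {X : τ → Ω → E} (hX : iIndepFun X P)
    (hm : ∀ a, Measurable (X a)) {s t : Finset τ} (hst : Disjoint s t)
    {f : (τ → E) → F} {g : (τ → E) → G} (hf : Measurable f) (hg : Measurable g)
    (hfs : DependsOn f s) (hgt : DependsOn g t) :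
    IndepFun (fun ω => f fun a => X a ω) (fun ω => g fun a => X a ω) P := by
  obtain ⟨f', hf', hff'⟩ := exists_measurable_comp_of_dependsOn hf hfs
  obtain ⟨g', hg', hgg'⟩ := exists_measurable_comp_of_dependsOn hg hgt
  simp only [hff', hgg']
  exact (hX.indepFun_finset s t hst hm).comp hf' hg'

lemma iIndepFun_curry {ι κ E : Type*} [Countable ι] [Countable κ] [MeasurableSpace E]
    {X : ι × κ → Ω → E} (hX : iIndepFun X P) (hm : ∀ a, Measurable (X a)) :
    iIndepFun (fun i ω j => X (i, j) ω) P := by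
  have := hX.isProbabilityMeasure
  have (i : ι) (j : κ) : IsProbabilityMeasure (P.map (X (i, j))) :=
    Measure.isProbabilityMeasure_map (hm _).aemeasurable
  have indep_sigma : iIndepFun (fun (q : Σ _ : ι, κ) => X (q.1, q.2)) P :=
    hX.precomp (Equiv.sigmaEquivProd ι κ).injective
  have indep_row (i : ι) : iIndepFun (fun j => X (i, j)) P := hX.precomp (Prod.mk_right_injective i)
  have curry_eq : (fun ω i j => X (i, j) ω) = MeasurableEquiv.piCurry (fun (_ : ι) (_ : κ) => E) ∘
      fun ω (q : Σ _ : ι, κ) => X (q.1, q.2) ω := by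
    ext
    simp [Sigma.curry]
  rw [iIndepFun_iff_map_fun_eq_infinitePi_map fun i => measurable_pi_iff.mpr fun j => hm (i, j),
    curry_eq, ← Measure.map_map (by fun_prop) (measurable_pi_iff.mpr fun _ => hm _),
    indep_sigma.map_fun_eq_infinitePi_map fun _ => hm _,
    Measure.infinitePi_map_piCurry fun i j => P.map (X (i, j))]
  congr 1
  ext1 i
  exact ((indep_row i).map_fun_eq_infinitePi_map fun j => hm (i, j)).symm

lemma integrable_prod_of_iIndepFun {ι E 𝕜 : Type*} [Fintype ι] [MeasurableSpace E] [RCLike 𝕜]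
    {V : ι → Ω → E} (hV : iIndepFun V P) (hm : ∀ i, Measurable (V i)) {f : ι → E → 𝕜}
    (hf : ∀ i, Measurable (f i)) (hint : ∀ i, Integrable (fun ω => f i (V i ω)) P) :
    Integrable (fun ω => ∏ i, f i (V i ω)) P := by
  have := hV.isProbabilityMeasure
  have (i : ι) : IsProbabilityMeasure (P.map (V i)) :=
    Measure.isProbabilityMeasure_map (hm i).aemeasurable
  have hpi : Integrable (fun x : ι → E => ∏ i, f i (x i)) (Measure.pi fun i => P.map (V i)) :=
    Integrable.fintype_prod fun i =>
      (integrable_map_measure (hf i).aestronglyMeasurable (hm i).aemeasurable).mpr (hint i)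
  rw [← hV.map_fun_eq_pi_map fun i => (hm i).aemeasurable] at hpi
  exact hpi.comp_measurable (measurable_pi_iff.mpr hm)

/-- Independent complex random variables with mean zero, unit variance and fourth absolute moment
at most `β`. -/
structure StandardFamily {τ : Type*} (X : τ → Ω → ℂ) (β : ℝ) (P : Measure Ω) : Prop where
  measurable (a : τ) : Measurable (X a)
  indep : iIndepFun X P
  mean (a : τ) : ∫ ω, X a ω ∂P = 0
  var (a : τ) : ∫ ω, ‖X a ω‖ ^ 2 ∂P = 1
  fourth_integrable (a : τ) : Integrable (fun ω => ‖X a ω‖ ^ 4) P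
  fourth_le (a : τ) : ∫ ω, ‖X a ω‖ ^ 4 ∂P ≤ β

/-- The centred rank-one matrix `v v* - 1`. -/
def centred {κ : Type*} [DecidableEq κ] (v : κ → ℂ) : Matrix κ κ ℂ :=
  Matrix.vecMulVec v (star v) - 1

variable {κ : Type*} [DecidableEq κ]

lemma centred_apply (v : κ → ℂ) (j k : κ) :
    centred v j k = v j * star (v k) - if j = k then 1 else 0 := by
  simp [centred, Matrix.vecMulVec_apply, Matrix.one_apply]

lemma star_centred (v : κ → ℂ) (j k : κ) : star (centred v j k) = centred v k j := by
  simp [centred_apply, mul_comm, eq_comm, apply_ite star]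

lemma norm_centred_comm (v : κ → ℂ) (j k : κ) : ‖centred v j k‖ = ‖centred v k j‖ := by
  rw [← star_centred, norm_star]

lemma centred_self (v : κ → ℂ) (j : κ) : centred v j j = ((‖v j‖ ^ 2 - 1 : ℝ) : ℂ) := by
  simp [centred_apply, Complex.mul_conj, Complex.normSq_eq_norm_sq]

lemma norm_centred_self_sq (v : κ → ℂ) (j : κ) :
    ‖centred v j j‖ ^ 2 = ‖v j‖ ^ 4 - 2 * ‖v j‖ ^ 2 + 1 := by
  rw [centred_self, Complex.norm_real, Real.norm_eq_abs, sq_abs]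
  ring

lemma norm_centred_of_ne (v : κ → ℂ) {j k : κ} (hjk : j ≠ k) :
    ‖centred v j k‖ = ‖v j‖ * ‖v k‖ := by
  simp [centred_apply, hjk]

lemma measurable_centred (j k : κ) : Measurable fun v : κ → ℂ => centred v j k := by
  simp only [centred_apply]
  fun_prop

lemma dependsOn_centred (j k : κ) : DependsOn (fun v : κ → ℂ => centred v j k) {j, k} :=
  fun v w h => by simp [centred_apply, h j, h k]

namespace StandardFamily

variable {X : κ → Ω → ℂ} {β : ℝ}

lemma memLp_four {τ : Type*} {X : τ → Ω → ℂ} (h : StandardFamily X β P) (a : τ) :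
    MemLp (X a) 4 P := by
  rw [← integrable_norm_rpow_iff (h.measurable a).aestronglyMeasurable (by norm_num) (by norm_num)]
  simpa using h.fourth_integrable a

lemma integrable_sq {τ : Type*} {X : τ → Ω → ℂ} (h : StandardFamily X β P) (a : τ) :
    Integrable (fun ω => ‖X a ω‖ ^ 2) P := by
  have := h.indep.isProbabilityMeasure
  exact ((h.memLp_four a).mono_exponent (by norm_num)).integrable_norm_pow (by norm_num)

lemma memLp_centred (h : StandardFamily X β P) (j k : κ) :
    MemLp (fun ω => centred (X · ω) j k) 2 P := by
  have := h.indep.isProbabilityMeasure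
  have : ENNReal.HolderTriple 4 4 2 := ⟨by
    rw [← two_mul, (by norm_num : (4 : ENNReal) = 2 * 2),
      ENNReal.mul_inv (by norm_num) (by norm_num), ← mul_assoc,
      ENNReal.mul_inv_cancel (by norm_num) (by norm_num), one_mul]⟩
  simp only [centred_apply]
  exact ((h.memLp_four k).star.mul (h.memLp_four j)).sub (memLp_const _)

lemma integral_mul_eq_zero_of_dependsOn {τ : Type*} {X : τ → Ω → ℂ} (h : StandardFamily X β P)
    {l : τ} {t : Finset τ} (hl : l ∉ t) {f g : (τ → ℂ) → ℂ} (hf : Measurable f) (hg : Measurable g)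
    (hfl : DependsOn f {l}) (hgt : DependsOn g t) (hf0 : ∫ ω, f (X · ω) ∂P = 0) :
    ∫ ω, f (X · ω) * g (X · ω) ∂P = 0 := by
  have hX : Measurable fun ω a => X a ω := measurable_pi_iff.mpr h.measurable
  have indep : IndepFun (fun ω => f (X · ω)) (fun ω => g (X · ω)) P :=
    indepFun_of_dependsOn h.indep h.measurable (Finset.disjoint_singleton_left.mpr hl)
      hf hg (by simpa using hfl) hgt
  rw [indep.integral_fun_mul_eq_mul_integral (hf.comp hX).aestronglyMeasurable
    (hg.comp hX).aestronglyMeasurable, hf0, zero_mul]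

lemma integral_centred_self (h : StandardFamily X β P) (j : κ) :
    ∫ ω, centred (X · ω) j j ∂P = 0 := by
  have := h.indep.isProbabilityMeasure
  simp only [centred_self]
  rw [integral_complex_ofReal, integral_sub (h.integrable_sq j) (integrable_const _), h.var j]
  simp

lemma integral_centred_mul_eq_zero_left (h : StandardFamily X β P) {j : κ} (k : κ)
    {t : Finset κ} (hj : j ∉ t) {g : (κ → ℂ) → ℂ} (hg : Measurable g) (hgt : DependsOn g t) :
    ∫ ω, centred (X · ω) j k * g (X · ω) ∂P = 0 := by
  rcases eq_or_ne j k with rfl | hjk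
  · exact h.integral_mul_eq_zero_of_dependsOn hj (measurable_centred j j) hg
      (by simpa using dependsOn_centred j j) hgt (h.integral_centred_self j)
  · simp only [centred_apply, hjk, if_false, sub_zero, mul_assoc]
    refine h.integral_mul_eq_zero_of_dependsOn (l := j) (t := insert k t) (by simp [hj, hjk])
      (f := fun v => v j) (g := fun v => star (v k) * g v) (by fun_prop) (by fun_prop)
      (fun v w hvw => hvw j rfl) (fun v w hvw => ?_) (h.mean j)
    simp [hvw k (by simp), hgt fun a ha => hvw a (by simp [Finset.mem_coe.mp ha])]

lemma integral_centred_mul_eq_zero_right (h : StandardFamily X β P) (j : κ) {k : κ}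
    {t : Finset κ} (hk : k ∉ t) {g : (κ → ℂ) → ℂ} (hg : Measurable g) (hgt : DependsOn g t) :
    ∫ ω, centred (X · ω) j k * g (X · ω) ∂P = 0 := by
  have conj_eq := h.integral_centred_mul_eq_zero_left j hk (g := fun v => star (g v))
    (by fun_prop) fun v w hvw => congrArg star (hgt hvw)
  simp only [← star_centred _ j k, ← star_mul'] at conj_eq
  rw [← star_eq_zero, Complex.star_def, ← integral_conj]
  exact conj_eq

lemma integral_centred (h : StandardFamily X β P) (j k : κ) :
    ∫ ω, centred (X · ω) j k ∂P = 0 := by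
  simpa using h.integral_centred_mul_eq_zero_left k (Finset.notMem_empty j) (g := 1)
    measurable_const fun _ _ _ => rfl

lemma integral_centred_mul_star_eq_zero (h : StandardFamily X β P) {j k j' k' : κ}
    (parallel : ¬(j = j' ∧ k = k')) (crossed : ¬(j = k' ∧ k = j')) :
    ∫ ω, centred (X · ω) j k * star (centred (X · ω) j' k') ∂P = 0 := by
  have vanish {j k j' k' : κ} (hjk : j ∉ ({k', j'} : Finset κ) ∨ k ∉ ({k', j'} : Finset κ)) :
      ∫ ω, centred (X · ω) j k * centred (X · ω) k' j' ∂P = 0 := by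
    have hdep := dependsOn_centred k' j'
    rcases hjk with hj | hk
    · exact h.integral_centred_mul_eq_zero_left k hj (measurable_centred k' j') (by simpa)
    · exact h.integral_centred_mul_eq_zero_right j hk (measurable_centred k' j') (by simpa)
  simp only [star_centred]
  by_cases hjk : j ∉ ({k', j'} : Finset κ) ∨ k ∉ ({k', j'} : Finset κ)
  · exact vanish hjk
  · simp only [mul_comm (centred _ j k)]
    exact vanish (by grind)

lemma integral_norm_centred_self_sq (h : StandardFamily X β P) (j : κ) :
    ∫ ω, ‖centred (X · ω) j j‖ ^ 2 ∂P = (∫ ω, ‖X j ω‖ ^ 4 ∂P) - 1 := by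
  have := h.indep.isProbabilityMeasure
  have h2 := (h.integrable_sq j).const_mul 2
  have h4 := h.fourth_integrable j
  simp only [norm_centred_self_sq]
  rw [integral_add (f := fun ω => ‖X j ω‖ ^ 4 - 2 * ‖X j ω‖ ^ 2) (h4.sub h2)
    (integrable_const _), integral_sub h4 h2, integral_const_mul, h.var j, integral_const,
    probReal_univ]
  norm_num
  ring

lemma integral_norm_centred_sq_of_ne (h : StandardFamily X β P) {j k : κ} (hjk : j ≠ k) :
    ∫ ω, ‖centred (X · ω) j k‖ ^ 2 ∂P = 1 := by
  have indep : IndepFun (fun ω => ‖X j ω‖ ^ 2) (fun ω => ‖X k ω‖ ^ 2) P :=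
    (h.indep.indepFun hjk).comp (φ := fun z => ‖z‖ ^ 2) (ψ := fun z => ‖z‖ ^ 2)
      (by fun_prop) (by fun_prop)
  simp only [norm_centred_of_ne _ hjk, mul_pow]
  rw [indep.integral_fun_mul_eq_mul_integral (h.integrable_sq j).aestronglyMeasurable
    (h.integrable_sq k).aestronglyMeasurable, h.var, h.var, mul_one]

lemma one_le {τ : Type*} {X : τ → Ω → ℂ} (h : StandardFamily X β P) (a : τ) : 1 ≤ β := by
  classical
  have : 0 ≤ ∫ ω, ‖centred (X · ω) a a‖ ^ 2 ∂P := integral_nonneg fun ω => sq_nonneg _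
  linarith [h.integral_norm_centred_self_sq a, h.fourth_le a]

lemma norm_integral_centred_mul_star_le (h : StandardFamily X β P) (j k j' k' : κ) :
    ‖∫ ω, centred (X · ω) j k * star (centred (X · ω) j' k') ∂P‖ ≤
      covBound (β - 1) j k j' k' := by
  have hβ : 0 ≤ β - 1 := sub_nonneg.mpr (h.one_le j)
  by_cases vanish : ¬(j = j' ∧ k = k') ∧ ¬(j = k' ∧ k = j')
  · rw [h.integral_centred_mul_star_eq_zero vanish.1 vanish.2, norm_zero, covBound]
    positivity
  have norm_eq (ω : Ω) : ‖centred (X · ω) j k * star (centred (X · ω) j' k')‖ =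
      ‖centred (X · ω) j k‖ ^ 2 := by
    rw [norm_mul, norm_star, sq]
    rcases (by tauto : (j = j' ∧ k = k') ∨ (j = k' ∧ k = j')) with ⟨rfl, rfl⟩ | ⟨rfl, rfl⟩
    · rfl
    · rw [norm_centred_comm _ k j]
  refine (norm_integral_le_integral_norm _).trans ?_
  simp only [norm_eq]
  rcases eq_or_ne j k with rfl | hjk
  · rw [h.integral_norm_centred_self_sq]
    have := h.fourth_le j
    grind [covBound]
  · rw [h.integral_norm_centred_sq_of_ne hjk]
    grind [covBound]

end StandardFamily

end Moments

section SecondMoment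

open Equiv (Perm)
open scoped Nat

variable {Ω : Type*} [MeasurableSpace Ω] {P : Measure Ω}

lemma integrable_mul_star {f g : Ω → ℂ} (hf : MemLp f 2 P) (hg : MemLp g 2 P) :
    Integrable (fun ω => f ω * star (g ω)) P :=
  hf.integrable_mul hg.star

lemma integral_sum_mul_star_sum {α α' : Type*} [Fintype α] [Fintype α'] {f : α → Ω → ℂ}
    {g : α' → Ω → ℂ} (hf : ∀ a, MemLp (f a) 2 P) (hg : ∀ b, MemLp (g b) 2 P) :
    ∫ ω, (∑ a, f a ω) * star (∑ b, g b ω) ∂P = ∑ a, ∑ b, ∫ ω, f a ω * star (g b ω) ∂P := by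
  simp only [star_sum, Finset.sum_mul_sum]
  rw [integral_finsetSum _ fun a _ =>
    integrable_finsetSum _ fun b _ => integrable_mul_star (hf a) (hg b)]
  exact Finset.sum_congr rfl fun a _ =>
    integral_finsetSum _ fun b _ => integrable_mul_star (hf a) (hg b)

lemma ofReal_integral_norm_sq (f : Ω → ℂ) :
    ((∫ ω, ‖f ω‖ ^ 2 ∂P : ℝ) : ℂ) = ∫ ω, f ω * star (f ω) ∂P := by
  rw [← integral_complex_ofReal]
  simp only [Complex.star_def, Complex.mul_conj, Complex.normSq_eq_norm_sq]

lemma integral_norm_sum_sq_of_orthogonal {α : Type*} [Fintype α] {f : α → Ω → ℂ}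
    (hf : ∀ a, MemLp (f a) 2 P)
    (orthogonal : Pairwise fun a b => ∫ ω, f a ω * star (f b ω) ∂P = 0) :
    ∫ ω, ‖∑ a, f a ω‖ ^ 2 ∂P = ∑ a, ∫ ω, ‖f a ω‖ ^ 2 ∂P := by
  rw [← Complex.ofReal_inj, ofReal_integral_norm_sq, integral_sum_mul_star_sum hf hf]
  push_cast
  refine Finset.sum_congr rfl fun a _ => ?_
  rw [ofReal_integral_norm_sq, Finset.sum_eq_single a (fun b _ hb => orthogonal hb.symm) (by simp)]

variable {ι κ : Type*} {X : ι × κ → Ω → ℂ} {β : ℝ}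

/-- The matrix with the given family of entries. -/
def entryMatrix (X : ι × κ → Ω → ℂ) (ω : Ω) : Matrix ι κ ℂ :=
  Matrix.of fun i j => X (i, j) ω

lemma StandardFamily.row (h : StandardFamily X β P) (i : ι) :
    StandardFamily (fun j => X (i, j)) β P where
  measurable j := h.measurable (i, j)
  indep := h.indep.precomp (Prod.mk_right_injective i)
  mean j := h.mean (i, j)
  var j := h.var (i, j)
  fourth_integrable j := h.fourth_integrable (i, j)
  fourth_le j := h.fourth_le (i, j)

lemma StandardFamily.iIndepFun_entryMatrix [Countable ι] [Countable κ]
    (h : StandardFamily X β P) : iIndepFun (fun i ω => entryMatrix X ω i) P :=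
  iIndepFun_curry h.indep h.measurable

lemma StandardFamily.measurable_entryMatrix_row (h : StandardFamily X β P) (i : ι) :
    Measurable fun ω => entryMatrix X ω i :=
  measurable_pi_iff.mpr fun j => h.measurable (i, j)

variable [DecidableEq ι] [DecidableEq κ]

/-- The factor of `minorTerm S q` contributed by row `i`, as a function of that row. -/
noncomputable def rowTerm (S : Finset ι) (q : (S ↪ κ) × Perm S) (i : ι) (v : κ → ℂ) : ℂ :=
  if h : i ∈ S then centred v (q.1 ⟨i, h⟩) (q.1 (q.2 ⟨i, h⟩)) else 1

lemma measurable_rowTerm (S : Finset ι) (q : (S ↪ κ) × Perm S) (i : ι) :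
    Measurable (rowTerm S q i) := by
  unfold rowTerm
  split_ifs
  · exact measurable_centred _ _
  · exact measurable_const

lemma StandardFamily.memLp_rowTerm (h : StandardFamily X β P) (S : Finset ι)
    (q : (S ↪ κ) × Perm S) (i : ι) : MemLp (fun ω => rowTerm S q i (entryMatrix X ω i)) 2 P := by
  have := h.indep.isProbabilityMeasure
  by_cases hi : i ∈ S
  · simp only [rowTerm, hi, dite_true]
    exact (h.row i).memLp_centred _ _
  · simpa only [rowTerm, hi, dite_false] using memLp_const (1 : ℂ)

section

variable [Fintype ι]

/-- The unsigned term of the Leibniz expansion of the mixed minor of the centred rows in `S` that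
is indexed by an injective choice of columns and a permutation. -/
noncomputable def minorTerm (S : Finset ι) (q : (S ↪ κ) × Perm S) (N : Matrix ι κ ℂ) : ℂ :=
  ∏ i, rowTerm S q i (N i)

namespace StandardFamily

variable [Countable κ]

lemma memLp_minorTerm (h : StandardFamily X β P) (S : Finset ι) (q : (S ↪ κ) × Perm S) :
    MemLp (fun ω => minorTerm S q (entryMatrix X ω)) 2 P := by
  have hmeas : Measurable fun ω => minorTerm S q (entryMatrix X ω) :=
    Finset.measurable_fun_prod _ fun i _ =>
      (measurable_rowTerm S q i).comp (h.measurable_entryMatrix_row i)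
  rw [memLp_two_iff_integrable_sq_norm hmeas.aestronglyMeasurable]
  simp only [minorTerm, norm_prod, ← Finset.prod_pow]
  exact integrable_prod_of_iIndepFun h.iIndepFun_entryMatrix h.measurable_entryMatrix_row
    (fun i => (measurable_rowTerm S q i).norm.pow_const 2)
    fun i => (h.memLp_rowTerm S q i).integrable_norm_pow (p := 2) two_ne_zero

lemma integral_minorTerm_mul_star (h : StandardFamily X β P) (S S' : Finset ι)
    (q : (S ↪ κ) × Perm S) (q' : (S' ↪ κ) × Perm S') :
    ∫ ω, minorTerm S q (entryMatrix X ω) * star (minorTerm S' q' (entryMatrix X ω)) ∂P =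
      ∏ i, ∫ ω, rowTerm S q i (entryMatrix X ω i) *
        star (rowTerm S' q' i (entryMatrix X ω i)) ∂P := by
  simp only [minorTerm, star_prod, ← Finset.prod_mul_distrib]
  exact h.iIndepFun_entryMatrix.integral_fun_prod_comp
    (fun i => (h.measurable_entryMatrix_row i).aemeasurable)
    (f := fun i v => rowTerm S q i v * star (rowTerm S' q' i v))
    fun i => ((measurable_rowTerm S q i).mul
      (continuous_star.measurable.comp (measurable_rowTerm S' q' i))).aestronglyMeasurable

lemma integral_minorTerm_mul_star_of_ne (h : StandardFamily X β P) {S S' : Finset ι}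
    (hS : S ≠ S') (q : (S ↪ κ) × Perm S) (q' : (S' ↪ κ) × Perm S') :
    ∫ ω, minorTerm S q (entryMatrix X ω) * star (minorTerm S' q' (entryMatrix X ω)) ∂P = 0 := by
  obtain ⟨i, hi⟩ : ∃ i, ¬(i ∈ S ↔ i ∈ S') := by simpa [Finset.ext_iff] using hS
  rw [h.integral_minorTerm_mul_star]
  refine Finset.prod_eq_zero (Finset.mem_univ i) ?_
  rcases (by tauto : (i ∈ S ∧ i ∉ S') ∨ (i ∉ S ∧ i ∈ S')) with ⟨hS, hS'⟩ | ⟨hS, hS'⟩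
  · simp only [rowTerm, hS, hS', dite_true, dite_false, star_one, mul_one]
    exact (h.row i).integral_centred _ _
  · simp only [rowTerm, hS, hS', dite_true, dite_false, one_mul, star_centred]
    exact (h.row i).integral_centred _ _

lemma norm_integral_minorTerm_mul_star_le (h : StandardFamily X β P) (S : Finset ι)
    (q r : (S ↪ κ) × Perm S) :
    ‖∫ ω, minorTerm S q (entryMatrix X ω) * star (minorTerm S r (entryMatrix X ω)) ∂P‖ ≤
      ∏ a, covBound (β - 1) (q.1 a) (q.1 (q.2 a)) (r.1 a) (r.1 (r.2 a)) := by
  have := h.indep.isProbabilityMeasure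
  rw [h.integral_minorTerm_mul_star, norm_prod]
  refine (Finset.prod_le_prod (fun i _ => norm_nonneg _) fun i _ => ?_).trans_eq
    (Finset.prod_attach_eq_prod_dite S
      fun a => covBound (β - 1) (q.1 a) (q.1 (q.2 a)) (r.1 a) (r.1 (r.2 a))).symm
  by_cases hi : i ∈ S
  · simp only [rowTerm, hi, dite_true]
    exact (h.row i).norm_integral_centred_mul_star_le _ _ _ _
  · simp [rowTerm, hi]

end StandardFamily

end

variable [Fintype κ]

lemma mixedMinor_centred_eq_sum_minorTerm [Fintype ι] (S : Finset ι) (N : Matrix ι κ ℂ) :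
    mixedMinor (fun a : S => centred (N a)) =
      ∑ q : (S ↪ κ) × Perm S, ((Perm.sign q.2 : ℤ) : ℂ) * minorTerm S q N := by
  rw [Fintype.sum_prod_type, mixedMinor]
  refine Finset.sum_congr rfl fun σ _ => ?_
  rw [← Matrix.det_transpose, Matrix.det_apply']
  refine Finset.sum_congr rfl fun ρ _ => congrArg _ ?_
  exact Finset.prod_attach_eq_prod_dite S fun a => centred (N a) (σ a) (σ (ρ a))

lemma norm_sign {α : Type*} [Fintype α] [DecidableEq α] (ρ : Perm α) :
    ‖((Perm.sign ρ : ℤ) : ℂ)‖ = 1 := by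
  rcases Int.units_eq_one_or (Perm.sign ρ) with h | h <;> simp [h]

lemma det_scalar_sub_gram [Fintype ι] (N : Matrix ι κ ℂ) (x : ℂ) :
    (Matrix.scalar ι x - N * Nᴴ).det =
      ∑ S : Finset ι, (-1) ^ S.card *
        laguerre (Fintype.card ι - S.card) (Fintype.card κ - S.card) x *
          mixedMinor fun a : S => centred (N a) :=
  det_scalar_sub_mul N Nᴴ x

namespace StandardFamily

lemma memLp_mixedMinor [Finite ι] (h : StandardFamily X β P) (S : Finset ι) :
    MemLp (fun ω => mixedMinor fun a : S => centred (entryMatrix X ω a)) 2 P := by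
  cases nonempty_fintype ι
  simp only [mixedMinor_centred_eq_sum_minorTerm]
  exact memLp_finsetSum _ fun q _ => (h.memLp_minorTerm S q).const_mul _

lemma integral_mixedMinor_mul_star [Fintype ι] (h : StandardFamily X β P) (S S' : Finset ι) :
    ∫ ω, (mixedMinor fun a : S => centred (entryMatrix X ω a)) *
        star (mixedMinor fun a : S' => centred (entryMatrix X ω a)) ∂P =
      ∑ q : (S ↪ κ) × Perm S, ∑ r : (S' ↪ κ) × Perm S',
        ((Perm.sign q.2 : ℤ) * star ((Perm.sign r.2 : ℤ) : ℂ)) *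
          ∫ ω, minorTerm S q (entryMatrix X ω) * star (minorTerm S' r (entryMatrix X ω)) ∂P := by
  simp only [mixedMinor_centred_eq_sum_minorTerm]
  rw [integral_sum_mul_star_sum (fun q => (h.memLp_minorTerm S q).const_mul _)
    fun r => (h.memLp_minorTerm S' r).const_mul _]
  simp only [star_mul', mul_mul_mul_comm _ (minorTerm _ _ _), integral_const_mul]

lemma integral_norm_mixedMinor_sq_le [Finite ι] (h : StandardFamily X β P) (hβ : 1 ≤ β)
    (S : Finset ι) :
    ∫ ω, ‖mixedMinor fun a : S => centred (entryMatrix X ω a)‖ ^ 2 ∂P ≤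
      (Fintype.card κ).descFactorial S.card * ((S.card + 1)! * Real.exp (β - 1)) := by
  cases nonempty_fintype ι
  have hsum := sum_prod_covBound_le (α := S) (κ := κ) (sub_nonneg.mpr hβ)
  rw [Fintype.card_coe] at hsum
  refine le_trans ?_ hsum
  rw [← Real.norm_of_nonneg (integral_nonneg fun ω => sq_nonneg _), ← Complex.norm_real,
    ofReal_integral_norm_sq, h.integral_mixedMinor_mul_star]
  refine norm_sum_le_of_le _ fun q _ => norm_sum_le_of_le _ fun r _ => ?_
  rw [norm_mul, norm_mul, norm_star, norm_sign, norm_sign, one_mul, one_mul]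
  exact h.norm_integral_minorTerm_mul_star_le S q r

lemma memLp_det [Fintype ι] {κ : Type*} [Fintype κ] {X : ι × κ → Ω → ℂ}
    (h : StandardFamily X β P) (x : ℂ) :
    MemLp (fun ω => (Matrix.scalar ι x - entryMatrix X ω * (entryMatrix X ω)ᴴ).det) 2 P := by
  classical
  simp only [det_scalar_sub_gram]
  exact memLp_finsetSum _ fun S _ => (h.memLp_mixedMinor S).const_mul _

lemma integral_norm_det_sq_le [Fintype ι] {κ : Type*} [Fintype κ] {X : ι × κ → Ω → ℂ}
    (h : StandardFamily X β P) (hβ : 1 ≤ β) (x : ℂ) :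
    ∫ ω, ‖(Matrix.scalar ι x - entryMatrix X ω * (entryMatrix X ω)ᴴ).det‖ ^ 2 ∂P ≤
      ∑ S : Finset ι, ‖laguerre (Fintype.card ι - S.card) (Fintype.card κ - S.card) x‖ ^ 2 *
        ((Fintype.card κ).descFactorial S.card * ((S.card + 1)! * Real.exp (β - 1))) := by
  classical
  simp only [det_scalar_sub_gram]
  rw [integral_norm_sum_sq_of_orthogonal fun S => (h.memLp_mixedMinor S).const_mul _]
  · refine Finset.sum_le_sum fun S _ => ?_
    simp only [norm_mul, mul_pow, norm_pow, norm_neg, norm_one, one_pow, one_mul,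
      integral_const_mul]
    gcongr
    exact h.integral_norm_mixedMinor_sq_le hβ S
  · intro S S' hS
    simp only [star_mul', mul_mul_mul_comm _ (mixedMinor _), integral_const_mul]
    simp only [h.integral_mixedMinor_mul_star, h.integral_minorTerm_mul_star_of_ne hS, mul_zero,
      Finset.sum_const_zero]

end StandardFamily

end SecondMoment

section Laguerre

open scoped Nat

lemma iteratedDeriv_exp_mul_one_sub_pow (p n : ℕ) (x : ℂ) :
    iteratedDeriv p (fun t => Complex.exp (x * t) * (1 - t) ^ n) 0 = laguerre p n x := by
  rw [iteratedDeriv_fun_mul (by fun_prop) (by fun_prop), laguerre, ← Finset.sum_range_reflect]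
  refine Finset.sum_congr rfl fun k hk => ?_
  have hk : k ≤ p := by simpa [Nat.lt_succ_iff] using hk
  have hpow : iteratedDeriv k (fun t : ℂ => (1 - t) ^ n) 0 = (-1) ^ k * n.descFactorial k := by
    rw [iteratedDeriv_comp_const_sub k (fun t : ℂ => t ^ n) 1]
    simp
  rw [Nat.add_sub_cancel, iteratedDeriv_cexp_const_mul, Nat.sub_sub_self hk, hpow,
    Nat.choose_symm hk]
  simp only [mul_zero, Complex.exp_zero, mul_one]
  ring

lemma pow_mul_exp_neg_le {n : ℕ} (hn : n ≠ 0) {x s : ℝ} (hx : 0 < x) (hs : 0 ≤ s) :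
    s ^ n * Real.exp (-(x * s)) ≤ (n / x) ^ n * Real.exp (-n) := by
  have hscaled : (x * s / n) ^ n ≤ Real.exp (x * s - n) := by
    calc (x * s / n) ^ n ≤ Real.exp (x * s / n - 1) ^ n := by
          gcongr
          linarith [Real.add_one_le_exp (x * s / n - 1)]
      _ = Real.exp (x * s - n) := by
          rw [← Real.exp_nat_mul]
          congr 1
          field_simp
  calc s ^ n * Real.exp (-(x * s))
      = (n / x) ^ n * ((x * s / n) ^ n * Real.exp (-(x * s))) := by
        rw [← mul_assoc, ← mul_pow]
        field_simp
    _ ≤ (n / x) ^ n * (Real.exp (x * s - n) * Real.exp (-(x * s))) := by gcongr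
    _ = (n / x) ^ n * Real.exp (-n) := by
        rw [← Real.exp_add]
        congr 2
        ring

lemma norm_exp_mul_one_sub_pow_sq_le {n : ℕ} (hn : n ≠ 0) {x : ℝ} (hx : 0 < x) (t : ℂ) :
    ‖Complex.exp (x * t) * (1 - t) ^ n‖ ^ 2 ≤
      Real.exp (x * (1 + ‖t‖ ^ 2) - n) * (n / x) ^ n := by
  have hre : 2 * (x * t.re) = x * (1 + ‖t‖ ^ 2) + -(x * ‖1 - t‖ ^ 2) := by
    simp only [← Complex.normSq_eq_norm_sq, Complex.normSq_apply, Complex.sub_re, Complex.sub_im,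
      Complex.one_re, Complex.one_im]
    ring
  have hexp : ‖Complex.exp (x * t)‖ ^ 2 =
      Real.exp (x * (1 + ‖t‖ ^ 2)) * Real.exp (-(x * ‖1 - t‖ ^ 2)) := by
    rw [Complex.norm_exp, Complex.re_ofReal_mul, ← Real.exp_nat_mul, Nat.cast_two, hre,
      Real.exp_add]
  calc ‖Complex.exp (x * t) * (1 - t) ^ n‖ ^ 2
      = Real.exp (x * (1 + ‖t‖ ^ 2)) *
          ((‖1 - t‖ ^ 2) ^ n * Real.exp (-(x * ‖1 - t‖ ^ 2))) := by
        rw [norm_mul, mul_pow, hexp, norm_pow]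
        ring
    _ ≤ Real.exp (x * (1 + ‖t‖ ^ 2)) * ((n / x) ^ n * Real.exp (-n)) := by
        exact mul_le_mul_of_nonneg_left (pow_mul_exp_neg_le hn hx (sq_nonneg _))
          (Real.exp_nonneg _)
    _ = Real.exp (x * (1 + ‖t‖ ^ 2) - n) * (n / x) ^ n := by
        rw [sub_eq_add_neg, Real.exp_add _ (-(n : ℝ))]
        ring

lemma norm_laguerre_sq_le {p n : ℕ} (hp : p ≠ 0) (hn : n ≠ 0) {x : ℝ} (hx : 0 < x) :
    ‖laguerre p n (x : ℂ)‖ ^ 2 ≤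
      (p ! : ℝ) ^ 2 * (x / p) ^ p * (Real.exp (x + p - n) * (n / x) ^ n) := by
  have : (0 : ℝ) < p := by exact_mod_cast Nat.pos_of_ne_zero hp
  set r := √(p / x)
  have hr : r ^ 2 = p / x := Real.sq_sqrt (by positivity)
  set B := Real.exp (x + p - n) * (n / x) ^ n
  -- `p / x` is the value of `r ^ 2` that minimises `exp (x * r ^ 2) / r ^ (2 * p)`.
  have hbound : ∀ t ∈ Metric.sphere (0 : ℂ) r, ‖Complex.exp (x * t) * (1 - t) ^ n‖ ≤ √B := by
    intro t ht
    refine Real.le_sqrt_of_sq_le ((norm_exp_mul_one_sub_pow_sq_le hn hx t).trans_eq ?_)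
    rw [mem_sphere_zero_iff_norm.mp ht, hr, mul_add, mul_div_cancel₀ _ hx.ne', mul_one]
  have hcauchy := Complex.norm_iteratedDeriv_le_of_forall_mem_sphere_norm_le (c := 0) p
    (Real.sqrt_pos.mpr (by positivity)) (f := fun t => Complex.exp (x * t) * (1 - t) ^ n)
    (Differentiable.diffContOnCl (by fun_prop)) hbound
  rw [iteratedDeriv_exp_mul_one_sub_pow] at hcauchy
  calc ‖laguerre p n (x : ℂ)‖ ^ 2 ≤ (p ! * √B / r ^ p) ^ 2 := by gcongr
    _ = (p ! : ℝ) ^ 2 * B / (r ^ 2) ^ p := by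
        rw [div_pow, mul_pow, Real.sq_sqrt (by positivity), ← pow_mul, ← pow_mul, mul_comm p 2]
    _ = (p ! : ℝ) ^ 2 * (x / p) ^ p * B := by
        rw [hr, div_pow, div_pow]
        field_simp

lemma factorial_le_exp_mul_sqrt {p : ℕ} (hp : p ≠ 0) :
    (p ! : ℝ) ≤ Real.exp 1 * √p * (p / Real.exp 1) ^ p := by
  obtain ⟨q, rfl⟩ := Nat.exists_eq_succ_of_ne_zero hp
  have hstirling : Stirling.stirlingSeq (q + 1) ≤ Stirling.stirlingSeq 1 :=
    Stirling.stirlingSeq'_antitone (Nat.zero_le q)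
  rw [Stirling.stirlingSeq_one, Stirling.stirlingSeq, div_le_iff₀ (by positivity)] at hstirling
  refine hstirling.trans_eq ?_
  rw [Real.sqrt_mul zero_le_two]
  field_simp

lemma pow_div_exp_le_factorial (n : ℕ) : ((n : ℝ) / Real.exp 1) ^ n ≤ n ! := by
  have h := Real.pow_div_factorial_le_exp (n : ℝ) n.cast_nonneg n
  rw [div_le_iff₀ (by positivity)] at h
  rwa [div_pow, div_le_iff₀ (by positivity), ← Real.exp_nat_mul, mul_one, mul_comm]

lemma norm_laguerre_sq_mul_pow_le_of_pos {p n : ℕ} (hp : p ≠ 0) (hpn : p ≤ n) {x : ℝ}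
    (hx : 0 < x) :
    ‖laguerre p n (x : ℂ)‖ ^ 2 * x ^ (n - p) ≤
      Real.exp 1 * √p * (p ! * n ! * Real.exp x) := by
  have hn : n ≠ 0 := (hp.bot_lt.trans_le hpn).ne'
  have : (0 : ℝ) < p := by exact_mod_cast Nat.pos_of_ne_zero hp
  have hxn : x ^ n = x ^ p * x ^ (n - p) := by rw [← pow_add, Nat.add_sub_cancel' hpn]
  calc ‖laguerre p n (x : ℂ)‖ ^ 2 * x ^ (n - p)
      ≤ (p ! : ℝ) ^ 2 * (x / p) ^ p * (Real.exp (x + p - n) * (n / x) ^ n) * x ^ (n - p) := by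
        gcongr
        exact norm_laguerre_sq_le hp hn hx
    _ = (p ! : ℝ) * Real.exp x * (n / Real.exp 1) ^ n * (p ! / (p / Real.exp 1) ^ p) := by
        rw [sub_eq_add_neg, Real.exp_add, Real.exp_add, Real.exp_neg, div_pow, div_pow, div_pow,
          div_pow, hxn, ← Real.exp_nat_mul, ← Real.exp_nat_mul, mul_one, mul_one]
        field_simp
    _ ≤ (p ! : ℝ) * Real.exp x * n ! * (Real.exp 1 * √p) := by
        gcongr
        · exact pow_div_exp_le_factorial n
        · exact (div_le_iff₀ (by positivity)).mpr (factorial_le_exp_mul_sqrt hp)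
    _ = Real.exp 1 * √p * (p ! * n ! * Real.exp x) := by ring

lemma norm_laguerre_sq_mul_pow_le {p n q : ℕ} (hpn : p ≤ n) (hpq : p ≤ q) (hq : 1 ≤ q) {x : ℝ}
    (hx : 0 ≤ x) :
    ‖laguerre p n (x : ℂ)‖ ^ 2 * x ^ (n - p) ≤
      Real.exp 1 * √q * (p ! * n ! * Real.exp x) := by
  rcases eq_or_ne p 0 with rfl | hp
  · have hexp : x ^ n ≤ Real.exp x * n ! :=
      (div_le_iff₀ (by positivity)).mp (Real.pow_div_factorial_le_exp x hx n)
    have hone : 1 ≤ Real.exp 1 * √q :=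
      one_le_mul_of_one_le_of_one_le (Real.one_le_exp zero_le_one)
        (Real.one_le_sqrt.mpr (by exact_mod_cast hq))
    calc ‖laguerre 0 n (x : ℂ)‖ ^ 2 * x ^ (n - 0) = x ^ n := by simp [laguerre]
      _ ≤ 1 * (Real.exp x * n !) := by rwa [one_mul]
      _ ≤ Real.exp 1 * √q * (Real.exp x * n !) := by gcongr
      _ = Real.exp 1 * √q * (0 ! * n ! * Real.exp x) := by
          rw [Nat.factorial_zero, Nat.cast_one]
          ring
  · have hcont : Continuous fun x : ℝ => ‖laguerre p n (x : ℂ)‖ ^ 2 * x ^ (n - p) := by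
      unfold laguerre
      fun_prop
    rw [← Set.mem_Ici, ← closure_Ioi] at hx
    refine le_on_closure (fun y (hy : 0 < y) => ?_) hcont.continuousOn
      (g := fun y => Real.exp 1 * √q * (p ! * n ! * Real.exp y)) (by fun_prop) hx
    refine (norm_laguerre_sq_mul_pow_le_of_pos hp hpn hy).trans ?_
    gcongr

end Laguerre

section LogIntegrals

open Real

lemma norm_sub_circleMap_sq (x θ : ℝ) :
    ‖(x : ℂ) - circleMap 0 1 θ‖ ^ 2 = 1 - 2 * x * cos θ + x ^ 2 := by
  rw [← Complex.normSq_eq_norm_sq, Complex.normSq_apply]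
  simp only [circleMap_zero, Complex.ofReal_one, one_mul, Complex.sub_re, Complex.sub_im,
    Complex.ofReal_re, Complex.ofReal_im, Complex.exp_ofReal_mul_I_re,
    Complex.exp_ofReal_mul_I_im]
  linear_combination sin_sq_add_cos_sq θ

/-- The Poisson kernel of the unit disc at the real point `x` and the boundary point `exp (iθ)`. -/
noncomputable def realPoisson (x θ : ℝ) : ℝ := poissonKernel 0 x (circleMap 0 1 θ)

lemma realPoisson_eq_div (x θ : ℝ) :
    realPoisson x θ = (1 - x ^ 2) / (1 - 2 * x * cos θ + x ^ 2) := by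
  simp [realPoisson, poissonKernel, norm_sub_rev (circleMap 0 1 θ), norm_sub_circleMap_sq]

lemma one_sub_two_mul_cos_add_sq_pos {x : ℝ} (hx : |x| < 1) (θ : ℝ) :
    0 < 1 - 2 * x * cos θ + x ^ 2 := by
  rw [← norm_sub_circleMap_sq, sq_pos_iff, norm_ne_zero_iff, sub_ne_zero]
  intro h
  have hnorm := congrArg norm h
  rw [Complex.norm_real, norm_circleMap_zero, abs_one] at hnorm
  exact hx.ne hnorm

lemma continuous_realPoisson {x : ℝ} (hx : |x| < 1) : Continuous (realPoisson x) := by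
  simp only [funext (realPoisson_eq_div x)]
  exact continuous_const.div (by fun_prop) fun θ => (one_sub_two_mul_cos_add_sq_pos hx θ).ne'

/-- `log |e^{iθ} - e^{iη}|`, the logarithmic potential of a point of the unit circle. -/
noncomputable def logChord (η θ : ℝ) : ℝ := log ‖circleMap 0 1 θ - circleMap 0 1 η‖

lemma norm_circleMap_sub_circleMap (θ η : ℝ) :
    ‖circleMap 0 1 θ - circleMap 0 1 η‖ = |2 * sin ((θ - η) / 2)| := by
  have hfactor : circleMap 0 1 θ - circleMap 0 1 η =
      circleMap 0 1 η * (Complex.exp (Complex.I * (θ - η : ℝ)) - 1) := by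
    rw [circleMap_zero, circleMap_zero, Complex.ofReal_one, one_mul, one_mul, mul_sub, mul_one,
      ← Complex.exp_add]
    push_cast
    ring_nf
  rw [hfactor, norm_mul, norm_circleMap_zero, abs_one, one_mul,
    Complex.norm_exp_I_mul_ofReal_sub_one, norm_eq_abs]

lemma logChord_eq_log_sin (η θ : ℝ) : logChord η θ = log (2 * sin ((θ - η) / 2)) := by
  rw [logChord, norm_circleMap_sub_circleMap, log_abs]

lemma intervalIntegrable_logChord (η : ℝ) :
    IntervalIntegrable (logChord η) volume 0 (2 * π) :=
  circleIntegrable_log_norm_sub_const (a := circleMap 0 1 η) (c := 0) 1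

lemma intervalIntegrable_mul_logChord {f : ℝ → ℝ} (hf : Continuous f) (η : ℝ) :
    IntervalIntegrable (fun θ => f θ * logChord η θ) volume 0 (2 * π) :=
  (intervalIntegrable_logChord η).continuousOn_mul hf.continuousOn

lemma integral_eq_of_circleAverage_eq {f : ℂ → ℝ} {a : ℝ} (h : circleAverage f 0 1 = a) :
    ∫ θ in (0)..(2 * π), f (circleMap 0 1 θ) = 2 * π * a := by
  rwa [circleAverage_def, smul_eq_mul, inv_mul_eq_iff_eq_mul₀ (by positivity)] at h

lemma integral_logChord (η : ℝ) : ∫ θ in (0)..(2 * π), logChord η θ = 0 :=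
  (integral_eq_of_circleAverage_eq (circleAverage_log_norm_sub_const₁ (by simp))).trans
    (mul_zero _)

lemma integral_realPoisson {x : ℝ} (hx : |x| < 1) :
    ∫ θ in (0)..(2 * π), realPoisson x θ = 2 * π := by
  have hball : (x : ℂ) ∈ Metric.ball 0 1 := by simpa using hx
  have h := (InnerProductSpace.harmonicOnNhd_const (1 : ℝ)).circleAverage_poissonKernel_smul hball
  simpa [realPoisson] using integral_eq_of_circleAverage_eq h

lemma integral_realPoisson_mul_logChord {x : ℝ} (hx : |x| < 1) (η : ℝ) :
    ∫ θ in (0)..(2 * π), realPoisson x θ * logChord η θ =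
      π * log (1 - 2 * x * cos η + x ^ 2) := by
  have hball : (x : ℂ) ∈ Metric.ball 0 1 := by simpa using hx
  have h := circleAverage_re_herglotzRieszKernel_mul_log (ρ := circleMap 0 1 η) (by simp) hball
  have hlog : 2 * log ‖(x : ℂ) - circleMap 0 1 η‖ = log (1 - 2 * x * cos η + x ^ 2) := by
    rw [← norm_sub_circleMap_sq, log_pow, Nat.cast_two]
  rw [← hlog, ← mul_assoc, mul_comm π 2, ← integral_eq_of_circleAverage_eq h]
  simp only [realPoisson, poissonKernel_eq_re_herglotzRieszKernel]
  rfl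

lemma countable_sin_half_sub_eq_zero (η : ℝ) : {θ | sin ((θ - η) / 2) = 0}.Countable := by
  refine (Set.countable_range fun n : ℤ => n * π * 2 + η).mono fun θ hθ => ?_
  obtain ⟨n, hn⟩ := sin_eq_zero_iff.mp hθ
  refine ⟨n, ?_⟩
  linear_combination 2 * hn

lemma sin_sub_sin_mul_logChord (η θ : ℝ) :
    (sin θ - sin η) * logChord η θ =
      cos ((θ + η) / 2) * (2 * sin ((θ - η) / 2) * log (2 * sin ((θ - η) / 2))) := by
  rw [logChord_eq_log_sin, sin_sub_sin]
  ring

lemma hasDerivAt_logChord {η θ : ℝ} (h : sin ((θ - η) / 2) ≠ 0) :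
    HasDerivAt (logChord η) (cos ((θ - η) / 2) / (2 * sin ((θ - η) / 2))) θ := by
  rw [funext (logChord_eq_log_sin η)]
  have hsin : HasDerivAt (fun θ => 2 * sin ((θ - η) / 2)) (cos ((θ - η) / 2)) θ := by
    refine (((((hasDerivAt_id θ).sub_const η).div_const 2).sin).const_mul 2).congr_deriv ?_
    simp only [id]
    ring
  exact hsin.log (mul_ne_zero two_ne_zero h)

lemma hasDerivAt_sin_sub_sin_mul_logChord {η θ : ℝ} (h : sin ((θ - η) / 2) ≠ 0) :
    HasDerivAt (fun θ => (sin θ - sin η) * logChord η θ)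
      (cos θ * logChord η θ + (cos θ + cos η) / 2) θ := by
  refine (((hasDerivAt_sin θ).sub_const _).mul (hasDerivAt_logChord h)).congr_deriv ?_
  rw [sin_sub_sin, cos_add_cos]
  field_simp

lemma integral_cos_mul_logChord (η : ℝ) :
    ∫ θ in (0)..(2 * π), cos θ * logChord η θ = -(π * cos η) := by
  have hcont : Continuous fun θ => (sin θ - sin η) * logChord η θ := by
    simp only [sin_sub_sin_mul_logChord]
    have := continuous_mul_log.comp
      (by fun_prop : Continuous fun θ => 2 * sin ((θ - η) / 2))
    exact (by fun_prop : Continuous fun θ => cos ((θ + η) / 2)).mul this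
  have hcos := intervalIntegrable_mul_logChord continuous_cos η
  have hrest : IntervalIntegrable (fun θ => (cos θ + cos η) / 2) volume 0 (2 * π) :=
    Continuous.intervalIntegrable (by fun_prop) _ _
  have hrest_integral : ∫ θ in (0)..(2 * π), (cos θ + cos η) / 2 = π * cos η := by
    rw [intervalIntegral.integral_div, intervalIntegral.integral_add
      (continuous_cos.intervalIntegrable _ _) intervalIntegrable_const, integral_cos,
      intervalIntegral.integral_const, sin_two_pi, sin_zero, smul_eq_mul]
    ring
  have hftc := integral_eq_of_hasDerivAt_off_countable _ _ (countable_sin_half_sub_eq_zero η)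
    hcont.continuousOn (fun θ hθ => hasDerivAt_sin_sub_sin_mul_logChord hθ.2) (hcos.add hrest)
  have hperiodic : logChord η (2 * π) = logChord η 0 := by
    simp [logChord, circleMap]
  rw [intervalIntegral.integral_add hcos hrest, hrest_integral, hperiodic, sin_two_pi, sin_zero,
    sub_self] at hftc
  linarith

end LogIntegrals

section LogPotential

open Real

/-- The angular parametrisation `θ ↦ |1 + s e^{iθ}|²` of the bulk `[a, b]`, where `s = √φ`. -/
noncomputable def bulkParam (s θ : ℝ) : ℝ := 1 + s ^ 2 + 2 * s * cos θ

lemma bulkParam_pos {s θ : ℝ} (hs : s ≠ 0) (hθ : sin θ ≠ 0) : 0 < bulkParam s θ := by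
  have hsq : bulkParam s θ = (1 + s * cos θ) ^ 2 + (s * sin θ) ^ 2 := by
    rw [bulkParam]
    linear_combination -s ^ 2 * sin_sq_add_cos_sq θ
  rw [hsq]
  positivity

lemma bulkParam_eq_realPoisson_denom (s θ : ℝ) :
    1 - 2 * -s * cos θ + (-s) ^ 2 = bulkParam s θ := by
  rw [bulkParam]
  ring

lemma image_bulkParam {s : ℝ} (hs : 0 < s) :
    bulkParam s '' Set.Icc 0 π = Set.Icc (lower (s ^ 2)) (upper (s ^ 2)) := by
  have hcomp : bulkParam s = (1 + s ^ 2 + ·) ∘ (2 * s * ·) ∘ cos := rfl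
  rw [hcomp, Set.image_comp, Set.image_comp, bijOn_cos.image_eq,
    Set.image_mul_left_Icc' (by positivity), Set.image_const_add_Icc, lower, upper, sqrt_sq hs.le]
  congr 1 <;> ring

lemma injOn_bulkParam {s : ℝ} (hs : s ≠ 0) : Set.InjOn (bulkParam s) (Set.Icc 0 π) := by
  intro θ hθ θ' hθ' h
  exact injOn_cos hθ hθ' (mul_left_cancel₀ (mul_ne_zero two_ne_zero hs) (add_left_cancel h))

lemma hasDerivAt_bulkParam (s θ : ℝ) : HasDerivAt (bulkParam s) (-(2 * s * sin θ)) θ :=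
  (((hasDerivAt_cos θ).const_mul (2 * s)).const_add (1 + s ^ 2)).congr_deriv (mul_neg _ _)

/-- The function `sin² θ / |1 + s e^{iθ}|²`, with the removable singularity that occurs for `s = 1`
filled in by splitting off the Poisson kernel. -/
noncomputable def arcWeight (s θ : ℝ) : ℝ :=
  (1 + s ^ 2) / (4 * s ^ 2) - 1 / (2 * s) * cos θ -
    (1 - s ^ 2) / (4 * s ^ 2) * realPoisson (-s) θ

lemma arcWeight_mul_bulkParam {s θ : ℝ} (hs : s ≠ 0) (h : bulkParam s θ ≠ 0) :
    arcWeight s θ * bulkParam s θ = sin θ ^ 2 := by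
  have hpoisson : realPoisson (-s) θ * bulkParam s θ = 1 - s ^ 2 := by
    rw [realPoisson_eq_div, bulkParam_eq_realPoisson_denom, div_mul_cancel₀ _ h, neg_sq]
  rw [arcWeight, sub_mul, mul_assoc ((1 - s ^ 2) / (4 * s ^ 2)), hpoisson, bulkParam, sin_sq]
  field_simp
  ring

lemma continuous_mul_realPoisson {s : ℝ} (hs : |s| ≤ 1) :
    Continuous fun θ => (1 - s ^ 2) / (4 * s ^ 2) * realPoisson (-s) θ := by
  rcases hs.lt_or_eq with h | h
  · exact continuous_const.mul (continuous_realPoisson (by rwa [abs_neg]))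
  · simpa [← sq_abs s, h] using continuous_const

lemma continuous_arcWeight {s : ℝ} (hs : |s| ≤ 1) : Continuous (arcWeight s) := by
  have h := continuous_mul_realPoisson hs
  unfold arcWeight
  fun_prop

lemma integral_mul_realPoisson {s : ℝ} (hs : |s| ≤ 1) :
    ∫ θ in (0)..(2 * π), (1 - s ^ 2) / (4 * s ^ 2) * realPoisson (-s) θ =
      (1 - s ^ 2) / (4 * s ^ 2) * (2 * π) := by
  rcases hs.lt_or_eq with h | h
  · rw [intervalIntegral.integral_const_mul, integral_realPoisson (by rwa [abs_neg])]
  · simp [← sq_abs s, h]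

lemma integral_arcWeight {s : ℝ} (hs0 : s ≠ 0) (hs : |s| ≤ 1) :
    ∫ θ in (0)..(2 * π), arcWeight s θ = π := by
  simp only [arcWeight]
  rw [intervalIntegral.integral_sub (Continuous.intervalIntegrable (by fun_prop) _ _)
      ((continuous_mul_realPoisson hs).intervalIntegrable _ _), integral_mul_realPoisson hs,
    intervalIntegral.integral_sub intervalIntegrable_const
      (Continuous.intervalIntegrable (by fun_prop) _ _), intervalIntegral.integral_const_mul,
    integral_cos, intervalIntegral.integral_const, sin_two_pi, sin_zero, smul_eq_mul]
  field_simp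
  ring

lemma integral_mul_realPoisson_mul_logChord {s : ℝ} (hs : |s| ≤ 1) (η : ℝ) :
    ∫ θ in (0)..(2 * π), (1 - s ^ 2) / (4 * s ^ 2) * realPoisson (-s) θ * logChord η θ =
      (1 - s ^ 2) / (4 * s ^ 2) * (π * log (bulkParam s η)) := by
  rcases hs.lt_or_eq with h | h
  · simp only [mul_assoc ((1 - s ^ 2) / (4 * s ^ 2))]
    rw [intervalIntegral.integral_const_mul,
      integral_realPoisson_mul_logChord (by rwa [abs_neg]), bulkParam_eq_realPoisson_denom]
  · simp [← sq_abs s, h]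

lemma integral_arcWeight_mul_logChord {s : ℝ} (hs0 : s ≠ 0) (hs : |s| ≤ 1) (η : ℝ) :
    ∫ θ in (0)..(2 * π), arcWeight s θ * logChord η θ =
      π * cos η / (2 * s) - (1 - s ^ 2) / (4 * s ^ 2) * (π * log (bulkParam s η)) := by
  have hcos := (intervalIntegrable_mul_logChord continuous_cos η).const_mul (1 / (2 * s))
  have hconst := (intervalIntegrable_logChord η).const_mul ((1 + s ^ 2) / (4 * s ^ 2))
  have hpoisson := intervalIntegrable_mul_logChord (continuous_mul_realPoisson hs) η
  simp only [arcWeight, sub_mul, mul_assoc (1 / (2 * s))]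
  rw [intervalIntegral.integral_sub (hconst.sub hcos) hpoisson,
    intervalIntegral.integral_sub hconst hcos, integral_mul_realPoisson_mul_logChord hs,
    intervalIntegral.integral_const_mul, intervalIntegral.integral_const_mul, integral_logChord,
    integral_cos_mul_logChord]
  field_simp
  ring

lemma norm_circleMap_sub_mul_norm (θ η : ℝ) :
    ‖circleMap 0 1 θ - circleMap 0 1 η‖ * ‖circleMap 0 1 θ - circleMap 0 1 (-η)‖ =
      |2 * (cos η - cos θ)| := by
  have hflip : (η - θ) / 2 = -((θ - η) / 2) := by ring
  rw [norm_circleMap_sub_circleMap, norm_circleMap_sub_circleMap, ← abs_mul, cos_sub_cos, hflip,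
    sin_neg, sub_neg_eq_add, add_comm η]
  ring_nf

lemma log_abs_bulkParam_sub {s θ η : ℝ} (hs : s ≠ 0) (h : cos η ≠ cos θ) :
    log |bulkParam s η - bulkParam s θ| = log s + (logChord η θ + logChord (-η) θ) := by
  have hprod := norm_circleMap_sub_mul_norm θ η
  have hne : |2 * (cos η - cos θ)| ≠ 0 :=
    abs_ne_zero.mpr (mul_ne_zero two_ne_zero (sub_ne_zero.mpr h))
  have hfactor : |bulkParam s η - bulkParam s θ| = |s| * |2 * (cos η - cos θ)| := by
    rw [bulkParam, bulkParam, ← abs_mul]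
    ring_nf
  rw [hfactor, log_mul (abs_ne_zero.mpr hs) hne, log_abs, ← hprod,
    log_mul (left_ne_zero_of_mul (hprod.trans_ne hne)) (right_ne_zero_of_mul (hprod.trans_ne hne)),
    logChord, logChord]

lemma countable_cos_eq (η : ℝ) : {θ | cos η = cos θ}.Countable := by
  refine ((Set.countable_range fun k : ℤ => 2 * k * π + η).union
    (Set.countable_range fun k : ℤ => 2 * k * π - η)).mono fun θ hθ => ?_
  obtain ⟨k, hk | hk⟩ := cos_eq_cos_iff.mp hθ
  exacts [.inl ⟨k, hk.symm⟩, .inr ⟨k, hk.symm⟩]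

lemma arcWeight_mul_log_ae_eq {s : ℝ} (hs : s ≠ 0) (η : ℝ) :
    (fun θ => arcWeight s θ * log |bulkParam s η - bulkParam s θ|) =ᵐ[volume] fun θ =>
      log s * arcWeight s θ + (arcWeight s θ * logChord η θ + arcWeight s θ * logChord (-η) θ) := by
  filter_upwards [(countable_cos_eq η).ae_notMem volume] with θ hθ
  rw [log_abs_bulkParam_sub hs hθ]
  ring

lemma intervalIntegrable_arcWeight_mul_log {s : ℝ} (hs0 : s ≠ 0) (hs : |s| ≤ 1) (η : ℝ) :
    IntervalIntegrable (fun θ => arcWeight s θ * log |bulkParam s η - bulkParam s θ|) volume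
      0 (2 * π) := by
  have hcont := continuous_arcWeight hs
  exact (((hcont.intervalIntegrable _ _).const_mul _).add
    ((intervalIntegrable_mul_logChord hcont η).add
      (intervalIntegrable_mul_logChord hcont (-η)))).congr_ae
    (ae_restrict_of_ae (arcWeight_mul_log_ae_eq hs0 η).symm)

lemma integral_arcWeight_mul_log {s : ℝ} (hs0 : s ≠ 0) (hs : |s| ≤ 1) (η : ℝ) :
    ∫ θ in (0)..(2 * π), arcWeight s θ * log |bulkParam s η - bulkParam s θ| =
      π * log s + π * cos η / s - (1 - s ^ 2) / (2 * s ^ 2) * (π * log (bulkParam s η)) := by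
  have hcont := continuous_arcWeight hs
  have hη := intervalIntegrable_mul_logChord hcont η
  have hη' := intervalIntegrable_mul_logChord hcont (-η)
  rw [intervalIntegral.integral_congr_ae_restrict
      (ae_restrict_of_ae (arcWeight_mul_log_ae_eq hs0 η)),
    intervalIntegral.integral_add ((hcont.intervalIntegrable _ _).const_mul _) (hη.add hη'),
    intervalIntegral.integral_add hη hη', intervalIntegral.integral_const_mul,
    integral_arcWeight hs0 hs, integral_arcWeight_mul_logChord hs0 hs,
    integral_arcWeight_mul_logChord hs0 hs, bulkParam, bulkParam, cos_neg]
  field_simp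
  ring

lemma integral_zero_pi_eq_half {f : ℝ → ℝ} (hf : IntervalIntegrable f volume 0 (2 * π))
    (hsymm : ∀ θ, f (2 * π - θ) = f θ) :
    ∫ θ in (0)..π, f θ = (∫ θ in (0)..(2 * π), f θ) / 2 := by
  have hpi : π ∈ Set.uIcc 0 (2 * π) := by
    rw [Set.uIcc_of_le two_pi_pos.le]
    constructor <;> linarith [pi_pos]
  have hadd := intervalIntegral.integral_add_adjacent_intervals
    (hf.mono_set (Set.uIcc_subset_uIcc_left hpi)) (hf.mono_set (Set.uIcc_subset_uIcc_right hpi))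
  have hreflect : ∫ θ in (0)..π, f θ = ∫ θ in π..(2 * π), f θ := by
    have := intervalIntegral.integral_comp_sub_left (a := 0) (b := π) f (2 * π)
    simp only [hsymm, sub_zero] at this
    rw [this, two_mul, add_sub_cancel_right]
  linarith

lemma lower_pos {φ : ℝ} (hφ : φ < 1) : 0 < lower φ :=
  pow_pos (sub_pos.mpr ((sqrt_lt' one_pos).mpr (by rwa [one_pow]))) 2

lemma density_eq_zero {φ t : ℝ} (ht : t ∉ Set.Icc (lower φ) (upper φ)) : density φ t = 0 := by
  have hle : lower φ ≤ upper φ := by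
    rw [lower, upper]
    nlinarith [sqrt_nonneg φ]
  have : (t - lower φ) * (upper φ - t) ≤ 0 := by
    rcases not_and_or.mp ht with h | h <;> push Not at h <;> nlinarith
  rw [density, max_eq_right this, sqrt_zero, mul_zero]

lemma density_nonneg (φ t : ℝ) : 0 ≤ density φ t := by
  by_cases ht : t ∈ Set.Icc (lower φ) (upper φ)
  · have : 0 ≤ t := (sq_nonneg _).trans ht.1
    unfold density
    positivity
  · rw [density_eq_zero ht]

lemma measurable_density (φ : ℝ) : Measurable (density φ) := by
  unfold density
  fun_prop

lemma abs_mul_density_bulkParam {s θ : ℝ} (hs : 0 < s) (hθ : sin θ ≠ 0) :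
    |-(2 * s * sin θ)| * density (s ^ 2) (bulkParam s θ) = 2 * s ^ 2 / π * arcWeight s θ := by
  have hpos : 0 < bulkParam s θ := bulkParam_pos hs.ne' hθ
  have hgap : (bulkParam s θ - lower (s ^ 2)) * (upper (s ^ 2) - bulkParam s θ) =
      (2 * s * sin θ) ^ 2 := by
    rw [lower, upper, sqrt_sq hs.le, mul_pow, sin_sq, bulkParam]
    ring
  rw [eq_div_of_mul_eq hpos.ne' (arcWeight_mul_bulkParam hs.ne' hpos.ne'), density, hgap,
    max_eq_left (sq_nonneg _), sqrt_sq_eq_abs, abs_neg, mul_left_comm, abs_mul_abs_self]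
  field_simp

lemma integrable_density_mul {s : ℝ} (hs : 0 < s) {g : ℝ → ℝ}
    (hg : IntervalIntegrable (fun θ => arcWeight s θ * g (bulkParam s θ)) volume 0 π) :
    Integrable fun t => density (s ^ 2) t * g t := by
  have hsupp : Function.support (fun t => density (s ^ 2) t * g t) ⊆
      Set.Icc (lower (s ^ 2)) (upper (s ^ 2)) := by
    intro t
    contrapose
    intro ht
    simp [density_eq_zero ht]
  rw [← integrableOn_iff_integrable_of_support_subset hsupp, ← image_bulkParam hs,
    integrableOn_image_iff_integrableOn_abs_deriv_smul measurableSet_Icc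
      (fun θ _ => (hasDerivAt_bulkParam s θ).hasDerivWithinAt) (injOn_bulkParam hs.ne'),
    integrableOn_Icc_iff_integrableOn_Ioo]
  rw [intervalIntegrable_iff_integrableOn_Ioo_of_le pi_pos.le] at hg
  refine IntegrableOn.congr_fun (hg.const_mul (2 * s ^ 2 / π)) (fun θ hθ => ?_) measurableSet_Ioo
  rw [smul_eq_mul, ← mul_assoc, ← mul_assoc,
    abs_mul_density_bulkParam hs (sin_pos_of_mem_Ioo hθ).ne']

lemma integral_density_mul {s : ℝ} (hs : 0 < s) (g : ℝ → ℝ) :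
    ∫ t, density (s ^ 2) t * g t =
      2 * s ^ 2 / π * ∫ θ in (0)..π, arcWeight s θ * g (bulkParam s θ) := by
  rw [← setIntegral_eq_integral_of_forall_compl_eq_zero
      (s := Set.Icc (lower (s ^ 2)) (upper (s ^ 2)))
      (fun t ht => by rw [density_eq_zero ht, zero_mul]),
    ← image_bulkParam hs, integral_image_eq_integral_abs_deriv_smul measurableSet_Icc
      (fun θ _ => (hasDerivAt_bulkParam s θ).hasDerivWithinAt) (injOn_bulkParam hs.ne'),
    integral_Icc_eq_integral_Ioo, intervalIntegral.integral_of_le pi_pos.le,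
    integral_Ioc_eq_integral_Ioo, ← integral_const_mul]
  refine setIntegral_congr_fun measurableSet_Ioo fun θ hθ => ?_
  rw [smul_eq_mul, ← mul_assoc, abs_mul_density_bulkParam hs (sin_pos_of_mem_Ioo hθ).ne',
    mul_assoc]

lemma integrable_density_mul_log {s : ℝ} (hs : 0 < s) (hs1 : s ≤ 1) (η : ℝ) :
    Integrable fun t => density (s ^ 2) t * log |bulkParam s η - t| := by
  refine integrable_density_mul hs (g := fun t => log |bulkParam s η - t|) ?_
  refine (intervalIntegrable_arcWeight_mul_log hs.ne' ((abs_of_pos hs).trans_le hs1) η).mono_set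
    (Set.uIcc_subset_uIcc_left ?_)
  rw [Set.uIcc_of_le two_pi_pos.le]
  constructor <;> linarith [pi_pos]

lemma integral_density_mul_log {s : ℝ} (hs : 0 < s) (hs1 : s ≤ 1) (η : ℝ) :
    ∫ t, density (s ^ 2) t * log |bulkParam s η - t| =
      s ^ 2 * log s + s * cos η - (1 - s ^ 2) / 2 * log (bulkParam s η) := by
  have hs1 : |s| ≤ 1 := (abs_of_pos hs).trans_le hs1
  rw [integral_density_mul hs fun t => log |bulkParam s η - t|,
    integral_zero_pi_eq_half (intervalIntegrable_arcWeight_mul_log hs.ne' hs1 η),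
    integral_arcWeight_mul_log hs.ne' hs1]
  · field_simp
  · intro θ
    simp only [arcWeight, bulkParam, realPoisson_eq_div, cos_two_pi_sub]

lemma logPotential_law_eq_add_integral {φ : ℝ} (hφ : φ ≤ 1) {z : ℝ}
    (hint : Integrable fun t => density φ t * log |z - t|) :
    logPotential (law φ) z = (1 - φ) * log |z| + ∫ t, density φ t * log |z - t| := by
  have hmeas : Measurable fun t => ENNReal.ofReal (density φ t) :=
    (measurable_density _).ennreal_ofReal
  have hlt : ∀ᵐ t : ℝ, ENNReal.ofReal (density φ t) < ⊤ :=
    ae_of_all _ fun _ => ENNReal.ofReal_lt_top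
  have hnorm (t : ℝ) : ‖(z : ℂ) - t‖ = |z - t| := by
    rw [← Complex.ofReal_sub, Complex.norm_real, norm_eq_abs]
  have hsmul (t : ℝ) : (ENNReal.ofReal (density φ t)).toReal • log |z - t| =
      density φ t * log |z - t| := by
    rw [ENNReal.toReal_ofReal (density_nonneg φ t), smul_eq_mul]
  simp only [logPotential, law, hnorm]
  rw [integral_add_measure, integral_smul_measure, integral_dirac,
    integral_withDensity_eq_integral_toReal_smul hmeas hlt]
  · simp only [hsmul, sub_zero, ENNReal.toReal_ofReal (sub_nonneg.mpr hφ), smul_eq_mul]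
  · exact (integrable_dirac (by simp)).smul_measure ENNReal.ofReal_ne_top
  · rw [integrable_withDensity_iff_integrable_smul' hmeas hlt]
    simpa only [hsmul] using hint

theorem logPotential_law {φ z : ℝ} (hφ : 0 < φ) (hφ1 : φ ≤ 1)
    (hz : z ∈ Set.Icc (lower φ) (upper φ)) :
    logPotential (law φ) z = (z + (1 - φ) * log z + φ * log φ - 1 - φ) / 2 := by
  obtain ⟨s, hs, rfl⟩ : ∃ s, 0 < s ∧ s ^ 2 = φ := ⟨√φ, sqrt_pos.mpr hφ, sq_sqrt hφ.le⟩
  have hs1 : s ≤ 1 := by nlinarith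
  obtain ⟨η, -, rfl⟩ := image_bulkParam hs ▸ hz
  rw [logPotential_law_eq_add_integral hφ1 (integrable_density_mul_log hs hs1 η),
    integral_density_mul_log hs hs1, log_abs, log_pow, bulkParam]
  push_cast
  ring

end LogPotential

section Conclusion

open scoped Nat

variable {p n : ℕ}

lemma det_smul_one_sub_covMatrix (hpn : p ≤ n) (hn : n ≠ 0) (M : Matrix (Fin p) (Fin n) ℂ)
    (z : ℂ) :
    (z • (1 : Matrix (Fin n) (Fin n) ℂ) - (n : ℂ)⁻¹ • covMatrix M).det =
      (n : ℂ)⁻¹ ^ n * (n * z) ^ (n - p) * (Matrix.scalar (Fin p) (n * z) - M * Mᴴ).det := by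
  have hscale : z • (1 : Matrix (Fin n) (Fin n) ℂ) - (n : ℂ)⁻¹ • covMatrix M =
      (n : ℂ)⁻¹ • (Matrix.scalar (Fin n) (n * z) - Mᴴ * M) := by
    rw [smul_sub, covMatrix, Matrix.scalar_apply, ← Matrix.smul_one_eq_diagonal, smul_smul,
      inv_mul_cancel_left₀ (Nat.cast_ne_zero.mpr hn)]
  rw [hscale, Matrix.det_smul, ← Matrix.eval_charpoly,
    Matrix.charpoly_mul_comm_of_le _ _ (by simpa using hpn), Polynomial.eval_mul,
    Polynomial.eval_pow, Polynomial.eval_X, Matrix.eval_charpoly, Fintype.card_fin,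
    Fintype.card_fin, mul_assoc]

lemma norm_det_smul_one_sub_covMatrix_sq (hpn : p ≤ n) (hn : n ≠ 0)
    (M : Matrix (Fin p) (Fin n) ℂ) (z : ℝ) :
    ‖((z : ℂ) • (1 : Matrix (Fin n) (Fin n) ℂ) - (n : ℂ)⁻¹ • covMatrix M).det‖ ^ 2 =
      ((n : ℝ)⁻¹ ^ n * (n * z) ^ (n - p)) ^ 2 *
        ‖(Matrix.scalar (Fin p) ((n * z : ℝ) : ℂ) - M * Mᴴ).det‖ ^ 2 := by
  have hcast : (n : ℂ)⁻¹ ^ n * (n * z) ^ (n - p) =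
      ((n : ℝ)⁻¹ ^ n * (n * z) ^ (n - p) : ℝ) := by
    push_cast
    rfl
  rw [det_smul_one_sub_covMatrix hpn hn, norm_mul, hcast, Complex.norm_real, mul_pow,
    Real.norm_eq_abs, sq_abs, Complex.ofReal_mul, Complex.ofReal_natCast]

lemma choose_mul_descFactorial_mul_factorial (hpn : p ≤ n) {m : ℕ} (hm : m ≤ p) :
    p.choose m * (n.descFactorial m * (m + 1)! * ((p - m)! * (n - m)!)) =
      (m + 1) * (p ! * n !) := by
  rw [← Nat.choose_mul_factorial_mul_factorial hm,
    ← Nat.factorial_mul_descFactorial (hm.trans hpn), Nat.factorial_succ]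
  ring

lemma sum_descFactorial_mul_factorial_le (hpn : p ≤ n) :
    ∑ S : Finset (Fin p),
        n.descFactorial S.card * (S.card + 1)! * ((p - S.card)! * (n - S.card)!) ≤
      (p + 1) ^ 2 * (p ! * n !) := by
  rw [← Finset.powerset_univ, Finset.sum_powerset_apply_card fun m =>
    n.descFactorial m * (m + 1)! * ((p - m)! * (n - m)!), Finset.card_univ, Fintype.card_fin]
  calc ∑ m ∈ Finset.range (p + 1),
        p.choose m • (n.descFactorial m * (m + 1)! * ((p - m)! * (n - m)!))
      ≤ ∑ _m ∈ Finset.range (p + 1), (p + 1) * (p ! * n !) := by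
        refine Finset.sum_le_sum fun m hm => ?_
        have hm : m ≤ p := Finset.mem_range_succ_iff.mp hm
        rw [smul_eq_mul, choose_mul_descFactorial_mul_factorial hpn hm]
        gcongr
    _ = (p + 1) ^ 2 * (p ! * n !) := by
        rw [Finset.sum_const, Finset.card_range, smul_eq_mul]
        ring

lemma norm_laguerre_sub_card_sq_mul_pow_le (hp : 1 ≤ p) (hpn : p ≤ n) (S : Finset (Fin p))
    {x : ℝ} (hx : 0 ≤ x) :
    ‖laguerre (p - S.card) (n - S.card) (x : ℂ)‖ ^ 2 * x ^ (n - p) ≤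
      Real.exp 1 * √p * ((p - S.card)! * (n - S.card)! * Real.exp x) := by
  have hS : S.card ≤ p := by simpa using S.card_le_univ
  have h := norm_laguerre_sq_mul_pow_le (Nat.sub_le_sub_right hpn S.card)
    (Nat.sub_le p S.card) hp hx
  rwa [tsub_tsub_tsub_cancel_right hS] at h

lemma StandardFamily.integral_norm_det_sq_mul_pow_le {Ω : Type*} [MeasurableSpace Ω]
    {P : Measure Ω} [IsProbabilityMeasure P] {β : ℝ} {X : Fin p × Fin n → Ω → ℂ}
    (h : StandardFamily X β P) (hp : 1 ≤ p) (hpn : p ≤ n) {x : ℝ} (hx : 0 ≤ x) :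
    (∫ ω, ‖(Matrix.scalar (Fin p) (x : ℂ) - entryMatrix X ω * (entryMatrix X ω)ᴴ).det‖ ^ 2 ∂P) *
        x ^ (n - p) ≤
      4 * p ^ 2 * √p * (p ! * n ! * Real.exp x) * Real.exp β := by
  have hβ : 1 ≤ β := h.one_le (⟨0, hp⟩, ⟨0, hp.trans hpn⟩)
  have hsum : ∑ S : Finset (Fin p),
      (n.descFactorial S.card * (S.card + 1)! * ((p - S.card)! * (n - S.card)!) : ℝ) ≤
        4 * p ^ 2 * (p ! * n !) := by
    have hp1 : p + 1 ≤ 2 * p := by lia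
    calc _ ≤ ((p + 1 : ℕ) : ℝ) ^ 2 * (p ! * n !) := by
          exact_mod_cast sum_descFactorial_mul_factorial_le hpn
      _ ≤ ((2 * p : ℕ) : ℝ) ^ 2 * (p ! * n !) := by gcongr
      _ = 4 * p ^ 2 * (p ! * n !) := by
          push_cast
          ring
  calc _ ≤ (∑ S : Finset (Fin p), ‖laguerre (p - S.card) (n - S.card) (x : ℂ)‖ ^ 2 *
          (n.descFactorial S.card * ((S.card + 1)! * Real.exp (β - 1)))) * x ^ (n - p) := by
        gcongr
        simpa only [Fintype.card_fin] using h.integral_norm_det_sq_le hβ (x : ℂ)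
    _ = ∑ S : Finset (Fin p), ‖laguerre (p - S.card) (n - S.card) (x : ℂ)‖ ^ 2 * x ^ (n - p) *
          (n.descFactorial S.card * (S.card + 1)! * Real.exp (β - 1)) := by
        rw [Finset.sum_mul]
        exact Finset.sum_congr rfl fun S _ => by ring
    _ ≤ ∑ S : Finset (Fin p),
          Real.exp 1 * √p * ((p - S.card)! * (n - S.card)! * Real.exp x) *
          (n.descFactorial S.card * (S.card + 1)! * Real.exp (β - 1)) := by
        exact Finset.sum_le_sum fun S _ => mul_le_mul_of_nonneg_right
          (norm_laguerre_sub_card_sq_mul_pow_le hp hpn S hx) (by positivity)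
    _ = Real.exp 1 * √p * Real.exp x * Real.exp (β - 1) * ∑ S : Finset (Fin p),
          (n.descFactorial S.card * (S.card + 1)! * ((p - S.card)! * (n - S.card)!) : ℝ) := by
        rw [Finset.mul_sum]
        exact Finset.sum_congr rfl fun S _ => by ring
    _ ≤ Real.exp 1 * √p * Real.exp x * Real.exp (β - 1) * (4 * p ^ 2 * (p ! * n !)) := by
        gcongr
    _ = 4 * p ^ 2 * √p * (p ! * n ! * Real.exp x) * Real.exp β := by
        rw [Real.exp_sub]
        field_simp

lemma exp_two_mul_logPotential (hp : 1 ≤ p) (hpn : p ≤ n) {z : ℝ}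
    (hz : z ∈ Set.Icc (lower (p / n)) (upper (p / n))) :
    Real.exp (2 * n * logPotential (law (p / n)) z) =
      z ^ (n - p) * (p / n) ^ p * Real.exp (n * z) / (Real.exp 1 ^ n * Real.exp 1 ^ p) := by
  have : (0 : ℝ) < p := by exact_mod_cast hp
  have hn0 : (0 : ℝ) < n := by exact_mod_cast hp.trans hpn
  have hφ : (0 : ℝ) < p / n := by positivity
  have hφ1 : (p / n : ℝ) ≤ 1 := (div_le_one hn0).mpr (by exact_mod_cast hpn)
  have hzpow : z ^ (n - p) = Real.exp ((n - p) * Real.log z) := by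
    rcases hpn.eq_or_lt with rfl | hlt
    · simp
    · have hz0 : 0 < z :=
        (lower_pos ((div_lt_one hn0).mpr (by exact_mod_cast hlt))).trans_le hz.1
      rw [← Nat.cast_sub hpn, Real.exp_nat_mul, Real.exp_log hz0]
  have hppow : (p / n : ℝ) ^ p = Real.exp (p * Real.log (p / n)) := by
    rw [Real.exp_nat_mul, Real.exp_log hφ]
  rw [logPotential_law hφ hφ1 hz, hzpow, hppow, ← Real.exp_nat_mul, ← Real.exp_nat_mul,
    ← Real.exp_add, ← Real.exp_add, ← Real.exp_add, ← Real.exp_sub]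
  congr 1
  field_simp
  ring

lemma pow_mul_factorial_le_exp_logPotential (hp : 1 ≤ p) (hpn : p ≤ n) {z : ℝ}
    (hz : z ∈ Set.Icc (lower (p / n)) (upper (p / n))) :
    (n : ℝ)⁻¹ ^ (2 * n) * (n * z) ^ (n - p) * (p ! * n ! * Real.exp (n * z)) ≤
      Real.exp 1 ^ 2 * √p * √n * Real.exp (2 * n * logPotential (law (p / n)) z) := by
  have hn0 : (0 : ℝ) < n := by exact_mod_cast hp.trans hpn
  have hz0 : 0 ≤ z := (sq_nonneg _).trans hz.1
  have hpow : (n : ℝ) ^ (2 * n) = n ^ (n - p) * n ^ n * n ^ p := by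
    rw [← pow_add, ← pow_add]
    congr 1
    lia
  calc _ ≤ (n : ℝ)⁻¹ ^ (2 * n) * (n * z) ^ (n - p) *
        ((Real.exp 1 * √p * (p / Real.exp 1) ^ p) *
          (Real.exp 1 * √n * (n / Real.exp 1) ^ n) * Real.exp (n * z)) := by
        gcongr
        · exact factorial_le_exp_mul_sqrt (by lia)
        · exact factorial_le_exp_mul_sqrt (by lia)
    _ = Real.exp 1 ^ 2 * √p * √n * (z ^ (n - p) * (p / n) ^ p * Real.exp (n * z) /
          (Real.exp 1 ^ n * Real.exp 1 ^ p)) := by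
        rw [inv_pow, hpow, mul_pow, div_pow, div_pow, div_pow]
        field_simp
    _ = _ := by rw [exp_two_mul_logPotential hp hpn hz]

end Conclusion

end MarchenkoPastur

open MarchenkoPastur in
theorem proposition3p1_general {n p : ℕ} (hp : 1 ≤ p) (hpn : p ≤ n) {Ω : Type*}
    [MeasurableSpace Ω] {P : Measure Ω} [IsProbabilityMeasure P] {β : ℝ}
    {M : Ω → Matrix (Fin p) (Fin n) ℂ}
    (h : StandardFamily (fun (ij : Fin p × Fin n) ω => M ω ij.1 ij.2) β P)
    {z : ℝ} (hz : z ∈ Set.Icc (lower (p / n)) (upper (p / n))) :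
    Integrable (fun ω => ‖((z : ℂ) • (1 : Matrix (Fin n) (Fin n) ℂ) -
        (n : ℂ)⁻¹ • covMatrix (M ω)).det‖ ^ 2) P ∧
      ∫ ω, ‖((z : ℂ) • (1 : Matrix (Fin n) (Fin n) ℂ) -
        (n : ℂ)⁻¹ • covMatrix (M ω)).det‖ ^ 2 ∂P ≤
      4 * Real.exp 1 ^ 2 * p ^ 3 * √n * Real.exp β *
        Real.exp (2 * n * logPotential (law (p / n)) z) := by
  have hz0 : 0 ≤ z := (sq_nonneg _).trans hz.1
  have hn : n ≠ 0 := by lia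
  have hmoment := h.integral_norm_det_sq_mul_pow_le hp hpn (mul_nonneg n.cast_nonneg hz0)
  simp_rw [norm_det_smul_one_sub_covMatrix_sq hpn hn]
  refine ⟨((h.memLp_det _).integrable_norm_pow two_ne_zero).const_mul _, ?_⟩
  rw [integral_const_mul]
  calc _ = (n : ℝ)⁻¹ ^ (2 * n) * (n * z) ^ (n - p) *
        ((∫ ω, ‖(Matrix.scalar (Fin p) ((n * z : ℝ) : ℂ) - M ω * (M ω)ᴴ).det‖ ^ 2 ∂P) *
          (n * z) ^ (n - p)) := by ring
    _ ≤ (n : ℝ)⁻¹ ^ (2 * n) * (n * z) ^ (n - p) *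
        (4 * p ^ 2 * √p * (p.factorial * n.factorial * Real.exp (n * z)) * Real.exp β) :=
        mul_le_mul_of_nonneg_left hmoment (by positivity)
    _ = 4 * p ^ 2 * √p * Real.exp β * ((n : ℝ)⁻¹ ^ (2 * n) * (n * z) ^ (n - p) *
        (p.factorial * n.factorial * Real.exp (n * z))) := by ring
    _ ≤ 4 * p ^ 2 * √p * Real.exp β * (Real.exp 1 ^ 2 * √p * √n *
        Real.exp (2 * n * logPotential (law (p / n)) z)) :=
        mul_le_mul_of_nonneg_left (pow_mul_factorial_le_exp_logPotential hp hpn hz)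
          (by positivity)
    _ = 4 * Real.exp 1 ^ 2 * p ^ 2 * (√p * √p) * √n * Real.exp β *
        Real.exp (2 * n * logPotential (law (p / n)) z) := by ring
    _ = _ := by
        rw [Real.mul_self_sqrt p.cast_nonneg]
        ring

theorem proposition3p1 :
    ∃ c : ℝ, 0 < c ∧
      ∀ (n p : ℕ), 1 ≤ p → p ≤ n →
      ∀ (Ω : Type*) [MeasurableSpace Ω] (P : Measure Ω) [IsProbabilityMeasure P]
        (β : ℝ) (M : Ω → Matrix (Fin p) (Fin n) ℂ),
        0 < β →
        (∀ i j, Measurable (fun ω => M ω i j)) →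
        iIndepFun (fun (ij : Fin p × Fin n) ω => M ω ij.1 ij.2) P →
        (∀ i j, ∫ ω, M ω i j ∂P = 0) →
        (∀ i j, ∫ ω, ‖M ω i j‖ ^ 2 ∂P = 1) →
        (∀ i j, Integrable (fun ω => ‖M ω i j‖ ^ 4) P ∧ ∫ ω, ‖M ω i j‖ ^ 4 ∂P ≤ β) →
      ∀ (φ : ℝ), φ = (p : ℝ) / (n : ℝ) →
      ∀ z ∈ Set.Icc (MarchenkoPastur.lower φ) (MarchenkoPastur.upper φ),
        Integrable (fun ω => ‖((z : ℂ) • (1 : Matrix (Fin n) (Fin n) ℂ) -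
          (n : ℂ)⁻¹ • MarchenkoPastur.covMatrix (M ω)).det‖ ^ 2) P ∧
        ∫ ω, ‖((z : ℂ) • (1 : Matrix (Fin n) (Fin n) ℂ) -
          (n : ℂ)⁻¹ • MarchenkoPastur.covMatrix (M ω)).det‖ ^ 2 ∂P ≤
        c * (p : ℝ) ^ (13 / 2 : ℝ) * (n : ℝ) ^ (1 / 2 : ℝ) * Real.exp β *
          Real.exp (2 * n * MarchenkoPastur.logPotential (MarchenkoPastur.law φ) (z : ℂ)) := by
  refine ⟨4 * Real.exp 1 ^ 2, by positivity, ?_⟩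
  rintro n p hp hpn Ω _ P _ β M - hmeas hindep hmean hvar hfourth φ rfl z hz
  have hM : MarchenkoPastur.StandardFamily (fun (ij : Fin p × Fin n) ω => M ω ij.1 ij.2) β P :=
    ⟨fun ij => hmeas ij.1 ij.2, hindep, fun ij => hmean ij.1 ij.2, fun ij => hvar ij.1 ij.2,
      fun ij => (hfourth ij.1 ij.2).1, fun ij => (hfourth ij.1 ij.2).2⟩
  obtain ⟨hint, hle⟩ := proposition3p1_general hp hpn hM hz
  have hpow : (p : ℝ) ^ 3 ≤ (p : ℝ) ^ (13 / 2 : ℝ) := by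
    rw [← Real.rpow_natCast]
    exact Real.rpow_le_rpow_of_exponent_le (by exact_mod_cast hp) (by norm_num)
  refine ⟨hint, hle.trans ?_⟩
  rw [← Real.sqrt_eq_rpow]
  gcongr
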